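/- Write $\theta_\lambda=\lambda\,\partial/\partial\lambda$, $\theta_\mu=\mu\,\partial/\partial\mu$; products of operators are compositions. Let $$\eta_0=(2\pi i)^2\sum_{n,m\ge0}(-1)^m\frac{(5m+2n)!}{n!\,(m!)^3\,(2m+n)!}\lambda^n\mu^m,\qquad \eta_1=(2\pi i)^2\sum_{n,m\ge0}(-1)^{m+n}\frac{(3n+3m)!}{(n!)^2(m!)^2(n+m)!}\lambda^n\mu^m,$$ $$\eta_2=(2\pi i)^2\sum_{n,m\ge0}(-1)^n\frac{(4m+3n)!}{(m!)^2\,n!\,((m+n)!)^2}\lambda^n\mu^m,\qquad \eta_3=(2\pi i)^2\sum_{n,m\ge0}(-1)^n\frac{(3n+2m)!}{(n!)^3(m!)^2}\lambda^n\mu^m$$ be the period power series of the families of K3 surfaces $S_0(\lambda,\mu):\ xyz^2(x+y+z+1)+\lambda xyz+\mu=0$, $S_1(\lambda,\mu):\ xyz(x+y+z+1)+\lambda x+\mu y=0$, $S_2(\lambda,\mu):\ xyz(x+y+z+1)+\lambda x+\mu=0$, $S_3(\lambda,\mu):\ xyz(x+y+z+1)+\lambda z+\mu xy=0$. Define \begin{align*}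 D_1^{(0)}&=\theta_\lambda(\theta_\lambda+2\theta_\mu)-\lambda(2\theta_\lambda+5\theta_\mu+1)(2\theta_\lambda+5\theta_\mu+2),\\ D_3^{(0)}&=\lambda^2(4\theta_\lambda^2-2\theta_\lambda\theta_\mu+5\theta_\mu^2)-8\lambda^3(1+3\theta_\lambda+5\theta_\mu+2\theta_\lambda^2+5\theta_\lambda\theta_\mu)+25\mu\theta_\lambda(\theta_\lambda-1),\\ D_1^{(1)}&=\lambda\theta_\mu^2-\mu\theta_\lambda^2,\\ D_3^{(1)}&=\tfrac1{27}\theta_\lambda^2+\lambda\bigl(\tfrac29+\theta_\lambda+\theta_\mu+\theta_\lambda^2+2\theta_\lambda\theta_\mu+\theta_\mu^2\bigr),\\ D_1^{(2)}&=\lambda\theta_\mu^2+\mu\theta_\lambda(3\theta_\lambda+4\theta_\mu+1),\\ D_3^{(2)}&=\lambda\theta_\lambda(3\theta_\lambda+2\theta_\mu)+\mu\theta_\lambda(1-\theta_\lambda)+9\lambda^2(3\theta_\lambda+4\theta_\mu+1)(3\theta_\lambda+4\theta_\mu+2),\\ D_1^{(3)}&=\theta_\mu^2-\mu(3\theta_\lambda+2\theta_\mu+1)(3\theta_\lambda+2\theta_\mu+2),\\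 D_3^{(3)}&=\theta_\lambda(3\theta_\lambda-2\theta_\mu)+9\lambda(3\theta_\lambda+2\theta_\mu+1)(3\theta_\lambda+2\theta_\mu+2)+4\mu\theta_\lambda(3\theta_\lambda+2\theta_\mu+1), \end{align*} and let $\Lambda_j=\{(\lambda,\mu)\in\mathbb C^2:\lambda\mu\,\delta_j(\lambda,\mu)\ne0\}$ with \begin{align*} \delta_0&=\lambda^2(4\lambda-1)^3-2(2+25\lambda(20\lambda-1))\mu-3125\mu^2,\\ \delta_1&=729\lambda^2-54\lambda(27\mu-1)+(1+27\mu)^2,\\ \delta_2&=\lambda^2(1+27\lambda)^2-2\lambda\mu(1+189\lambda)+(1+576\lambda)\mu^2-256\mu^3,\\ \delta_3&=729\lambda^2-(4\mu-1)^3+54\lambda(1+12\mu). \end{align*} Theorem. Let $j\in\{0,1,2,3\}$. The series $\eta_j$ converges absolutely in a neighbourhood of $(0,0)$, its sum is holomorphic at $(0,0)$, and $D_1^{(j)}\eta_j=D_3^{(j)}\eta_j=0$ near $(0,0)$. The solution space of the system $D_1^{(j)}u=D_3^{(j)}u=0$ is $4$-dimensional: at every point of $\Lambda_j$ the $\mathbb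 C$-vector space of germs of holomorphic functions $u$ satisfying the system has dimension exactly $4$. -/

import Mathlib

open Filter Topology

namespace PeriodDE

/-- Germs at `p` of holomorphic functions of two complex variables `(lam, mu)`. -/
noncomputable def HolGerm (p : ℂ × ℂ) : Submodule ℂ (Germ (𝓝 p) ℂ) where
  carrier := {g | ∃ u : ℂ × ℂ → ℂ, AnalyticAt ℂ u p ∧ (u : Germ (𝓝 p) ℂ) = g}
  zero_mem' := ⟨fun _ => 0, analyticAt_const, rfl⟩
  add_mem' := by
    rintro _ _ ⟨u, hu, rfl⟩ ⟨v, hv, rfl⟩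
    exact ⟨u + v, hu.add hv, rfl⟩
  smul_mem' := by
    rintro c _ ⟨u, hu, rfl⟩
    exact ⟨c • u, analyticAt_const.smul hu, rfl⟩

/-- The germ at `p` of a function which is holomorphic near `p`. -/
noncomputable def HolGerm.of {p : ℂ × ℂ} (u : ℂ × ℂ → ℂ) (hu : AnalyticAt ℂ u p) : HolGerm p :=
  ⟨(u : Germ (𝓝 p) ℂ), u, hu, rfl⟩

/-- Multiplication of holomorphic germs at `p` by a fixed function holomorphic near `p`. -/
noncomputable def mulOp (p : ℂ × ℂ) (f : ℂ × ℂ → ℂ) (hf : AnalyticAt ℂ f p) :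
    Module.End ℂ (HolGerm p) where
  toFun g := ⟨(f : Germ (𝓝 p) ℂ) * g.1, by
    obtain ⟨_, u, hu, rfl⟩ := g
    exact ⟨f * u, hf.mul hu, rfl⟩⟩
  map_add' g h := Subtype.ext (mul_add _ _ _)
  map_smul' c g := by
    obtain ⟨_, u, hu, rfl⟩ := g
    refine Subtype.ext (congrArg (fun w : ℂ × ℂ → ℂ => (w : Germ (𝓝 p) ℂ)) ?_)
    exact mul_smul_comm c f u

/-- The derivative of holomorphic germs at `p` in the constant direction `v`. -/
noncomputable def derivOp (p v : ℂ × ℂ) : Module.End ℂ (HolGerm p) where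
  toFun g := ⟨Germ.map' (fun (u : ℂ × ℂ → ℂ) q => fderiv ℂ u q v)
      (fun _ _ h => (h.fderiv (𝕜 := ℂ)).fun_comp (fun A => A v)) g.1, by
    obtain ⟨_, u, hu, rfl⟩ := g
    exact ⟨fun q => fderiv ℂ u q v,
      (ContinuousLinearMap.analyticAt (ContinuousLinearMap.apply ℂ ℂ v) _).comp hu.fderiv, rfl⟩⟩
  map_add' g h := by
    obtain ⟨_, u, hu, rfl⟩ := g
    obtain ⟨_, w, hw, rfl⟩ := h
    refine Subtype.ext (Germ.coe_eq.2 ?_)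
    filter_upwards [hu.eventually_analyticAt, hw.eventually_analyticAt] with q h1 h2
    change fderiv ℂ (u + w) q v = fderiv ℂ u q v + fderiv ℂ w q v
    rw [fderiv_add h1.differentiableAt h2.differentiableAt, add_apply]
  map_smul' c g := by
    obtain ⟨_, u, hu, rfl⟩ := g
    refine Subtype.ext (Germ.coe_eq.2 ?_)
    filter_upwards [hu.eventually_analyticAt] with q h1
    change fderiv ℂ (c • u) q v = c • fderiv ℂ u q v
    rw [fderiv_const_smul h1.differentiableAt, smul_apply]

/-- Multiplication by the coordinate `lam`. -/
noncomputable def lamOp (p : ℂ × ℂ) : Module.End ℂ (HolGerm p) :=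
  mulOp p Prod.fst analyticAt_fst

/-- Multiplication by the coordinate `mu`. -/
noncomputable def muOp (p : ℂ × ℂ) : Module.End ℂ (HolGerm p) :=
  mulOp p Prod.snd analyticAt_snd

/-- The Euler operator `lam * ∂/∂lam`. -/
noncomputable def thetaLam (p : ℂ × ℂ) : Module.End ℂ (HolGerm p) :=
  lamOp p * derivOp p (1, 0)

/-- The Euler operator `mu * ∂/∂mu`. -/
noncomputable def thetaMu (p : ℂ × ℂ) : Module.End ℂ (HolGerm p) :=
  muOp p * derivOp p (0, 1)

/-- The operators `D₁⁽ʲ⁾`, acting on holomorphic germs at `p`.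
The product of operators is composition. -/
noncomputable def D1 (p : ℂ × ℂ) (j : Fin 4) : Module.End ℂ (HolGerm p) :=
  let L := lamOp p
  let M := muOp p
  let X := thetaLam p
  let Y := thetaMu p
  match j with
  | 0 => X * (X + 2 * Y) - L * (2 * X + 5 * Y + 1) * (2 * X + 5 * Y + 2)
  | 1 => L * Y ^ 2 - M * X ^ 2
  | 2 => L * Y ^ 2 + M * X * (3 * X + 4 * Y + 1)
  | 3 => Y ^ 2 - M * (3 * X + 2 * Y + 1) * (3 * X + 2 * Y + 2)

/-- The operators `D₃⁽ʲ⁾`, acting on holomorphic germs at `p`.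
The product of operators is composition. -/
noncomputable def D3 (p : ℂ × ℂ) (j : Fin 4) : Module.End ℂ (HolGerm p) :=
  let L := lamOp p
  let M := muOp p
  let X := thetaLam p
  let Y := thetaMu p
  match j with
  | 0 => L ^ 2 * (4 * X ^ 2 - 2 * X * Y + 5 * Y ^ 2)
      - 8 * L ^ 3 * (1 + 3 * X + 5 * Y + 2 * X ^ 2 + 5 * X * Y)
      + 25 * M * X * (X - 1)
  | 1 => (1 / 27 : ℂ) • X ^ 2
      + L * ((2 / 9 : ℂ) • 1 + X + Y + X ^ 2 + 2 * X * Y + Y ^ 2)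
  | 2 => L * X * (3 * X + 2 * Y) + M * X * (1 - X)
      + 9 * L ^ 2 * (3 * X + 4 * Y + 1) * (3 * X + 4 * Y + 2)
  | 3 => X * (3 * X - 2 * Y) + 9 * L * (3 * X + 2 * Y + 1) * (3 * X + 2 * Y + 2)
      + 4 * M * X * (3 * X + 2 * Y + 1)

/-- The space of holomorphic germs `u` at `p` with `D₁⁽ʲ⁾ u = D₃⁽ʲ⁾ u = 0`. -/
noncomputable def solutions (p : ℂ × ℂ) (j : Fin 4) : Submodule ℂ (HolGerm p) :=
  LinearMap.ker (D1 p j) ⊓ LinearMap.ker (D3 p j)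

/-- The coefficient of `lam ^ n * mu ^ m` in `η_j / (2πi)²`. -/
noncomputable def etaCoeff (j : Fin 4) (n m : ℕ) : ℂ :=
  match j with
  | 0 => (-1) ^ m * ((5 * m + 2 * n).factorial : ℂ) /
      ((n.factorial : ℂ) * (m.factorial : ℂ) ^ 3 * ((2 * m + n).factorial : ℂ))
  | 1 => (-1) ^ (m + n) * ((3 * n + 3 * m).factorial : ℂ) /
      ((n.factorial : ℂ) ^ 2 * (m.factorial : ℂ) ^ 2 * ((n + m).factorial : ℂ))
  | 2 => (-1) ^ n * ((4 * m + 3 * n).factorial : ℂ) /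
      ((m.factorial : ℂ) ^ 2 * (n.factorial : ℂ) * ((m + n).factorial : ℂ) ^ 2)
  | 3 => (-1) ^ n * ((3 * n + 2 * m).factorial : ℂ) /
      ((n.factorial : ℂ) ^ 3 * (m.factorial : ℂ) ^ 2)

/-- The general term of the power series `η_j / (2πi)²` at `p = (lam, mu)`. -/
noncomputable def etaTerm (j : Fin 4) (p : ℂ × ℂ) (k : ℕ × ℕ) : ℂ :=
  etaCoeff j k.1 k.2 * p.1 ^ k.1 * p.2 ^ k.2

/-- The period power series `η_j`, as the sum of the series. -/
noncomputable def eta (j : Fin 4) (p : ℂ × ℂ) : ℂ :=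
  (2 * (Real.pi : ℂ) * Complex.I) ^ 2 * ∑' k : ℕ × ℕ, etaTerm j p k

/-- The nontrivial factor of the equation of the complement of `Lambda j`. -/
noncomputable def discr (j : Fin 4) (p : ℂ × ℂ) : ℂ :=
  let l := p.1
  let m := p.2
  match j with
  | 0 => l ^ 2 * (4 * l - 1) ^ 3 - 2 * (2 + 25 * l * (20 * l - 1)) * m - 3125 * m ^ 2
  | 1 => 729 * l ^ 2 - 54 * l * (27 * m - 1) + (1 + 27 * m) ^ 2
  | 2 => l ^ 2 * (1 + 27 * l) ^ 2 - 2 * l * m * (1 + 189 * l) + (1 + 576 * l) * m ^ 2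
      - 256 * m ^ 3
  | 3 => 729 * l ^ 2 - (4 * m - 1) ^ 3 + 54 * l * (1 + 12 * m)

/-- The parameter domain `Λ_j` of the `j`-th family. -/
def Lambda (j : Fin 4) : Set (ℂ × ℂ) := {p | p.1 * p.2 * discr j p ≠ 0}

end PeriodDE

namespace PeriodDE

/-! ### The ring of germs of holomorphic functions -/

/-! The rank statement and the statement about the series are proved independently.

Rank. Written in `∂/∂lam` and `∂/∂mu`, both operators have order two, and their principal symbols
are binary quadratic forms. The resultant of these forms is a nonzero constant times a monomial in
`lam`, `mu` times `discr j` (`symbolRes_ne_zero`), so on `Lambda j` there is no common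
characteristic direction. The six derivatives of order at most two then satisfy two independent
linear equations, leaving a constraint bundle of rank 4. Differentiating both equations in both
directions gives four linear equations for the four third derivatives, with the Sylvester matrix of
the symbols as coefficient matrix. Hence the 2-jet of a solution is a flat section of an explicit
connection `conn` on jets, and it is determined by its value at one point: the dimension is at most
4.

For equality the connection must be integrable on the constraint bundle. The only possible
obstruction comes from the Koszul relation between the two symbols, and `syzygy` removes it: it
lifts that relation to `(D3 + A) D1 = (D1 + B) D3` with `A`, `B` of order at most one. Testing the
connection on cubic germs whose third derivatives are the prescribed ones then shows that the
curvature kills constrained jets (`conn_curvature`). The Frobenius theorem `exists_flat_section`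
puts a flat section through every constrained jet, and its zeroth component is a solution. Frobenius
itself is obtained by solving an ODE along each ray from the base point, with analytic dependence on
the direction.

Series. Up to sign the coefficients are multinomial coefficients, hence of geometric growth. On
coefficients the Euler operators act diagonally and `lam`, `mu` act as shifts, so the differential
equations become recurrences between quotients of factorials. -/

noncomputable instance HolGerm.instMul (p : ℂ × ℂ) : Mul (HolGerm p) where
  mul g h := ⟨g.1 * h.1, by
    obtain ⟨_, u, hu, rfl⟩ := g
    obtain ⟨_, v, hv, rfl⟩ := h
    exact ⟨u * v, hu.mul hv, rfl⟩⟩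

noncomputable instance HolGerm.instOne (p : ℂ × ℂ) : One (HolGerm p) where
  one := ⟨1, fun _ => 1, analyticAt_const, rfl⟩

noncomputable instance HolGerm.instCommRing (p : ℂ × ℂ) : CommRing (HolGerm p) where
  __ := (inferInstance : AddCommGroup (HolGerm p))
  mul_assoc a b c := Subtype.ext (mul_assoc _ _ _)
  mul_comm a b := Subtype.ext (mul_comm _ _)
  one_mul a := Subtype.ext (one_mul _)
  mul_one a := Subtype.ext (mul_one _)
  left_distrib a b c := Subtype.ext (mul_add _ _ _)
  right_distrib a b c := Subtype.ext (add_mul _ _ _)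
  zero_mul a := Subtype.ext (zero_mul _)
  mul_zero a := Subtype.ext (mul_zero _)

theorem HolGerm.exists_of {p : ℂ × ℂ} (g : HolGerm p) :
    ∃ (u : ℂ × ℂ → ℂ) (hu : AnalyticAt ℂ u p), HolGerm.of u hu = g := by
  obtain ⟨_, u, hu, rfl⟩ := g
  exact ⟨u, hu, rfl⟩

theorem HolGerm.of_eq_of {p : ℂ × ℂ} {u v : ℂ × ℂ → ℂ} {hu : AnalyticAt ℂ u p}
    {hv : AnalyticAt ℂ v p} : HolGerm.of u hu = HolGerm.of v hv ↔ u =ᶠ[𝓝 p] v :=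
  Subtype.ext_iff.trans Germ.coe_eq

theorem HolGerm.of_add {p : ℂ × ℂ} {u v : ℂ × ℂ → ℂ} (hu : AnalyticAt ℂ u p)
    (hv : AnalyticAt ℂ v p) :
    HolGerm.of u hu + HolGerm.of v hv = HolGerm.of (fun q => u q + v q) (hu.add hv) := rfl

theorem HolGerm.of_mul {p : ℂ × ℂ} {u v : ℂ × ℂ → ℂ} (hu : AnalyticAt ℂ u p)
    (hv : AnalyticAt ℂ v p) :
    HolGerm.of u hu * HolGerm.of v hv = HolGerm.of (fun q => u q * v q) (hu.mul hv) := rfl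

/-- Constant germs. -/
noncomputable def HolGerm.const (p : ℂ × ℂ) (c : ℂ) : HolGerm p :=
  HolGerm.of (fun _ => c) analyticAt_const

theorem HolGerm.smul_eq_const_mul {p : ℂ × ℂ} (c : ℂ) (g : HolGerm p) :
    c • g = HolGerm.const p c * g := by
  obtain ⟨u, hu, rfl⟩ := HolGerm.exists_of g
  rfl

theorem HolGerm.const_mul_const (p : ℂ × ℂ) (c d : ℂ) :
    HolGerm.const p c * HolGerm.const p d = HolGerm.const p (c * d) := rfl

/-- Constant germs, as a ring homomorphism. -/
noncomputable def HolGerm.constHom (p : ℂ × ℂ) : ℂ →+* HolGerm p where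
  toFun := HolGerm.const p
  map_one' := rfl
  map_mul' _ _ := rfl
  map_zero' := rfl
  map_add' _ _ := rfl

theorem HolGerm.const_ofNat (p : ℂ × ℂ) (n : ℕ) [n.AtLeastTwo] :
    HolGerm.const p (ofNat(n) : ℂ) = ofNat(n) := map_ofNat (HolGerm.constHom p) n

/-- The value of a germ at its base point. -/
noncomputable def HolGerm.ev (p : ℂ × ℂ) : HolGerm p →+* ℂ where
  toFun g := g.1.value
  map_one' := rfl
  map_mul' g h := by
    obtain ⟨u, hu, rfl⟩ := HolGerm.exists_of g
    obtain ⟨v, hv, rfl⟩ := HolGerm.exists_of h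
    rfl
  map_zero' := rfl
  map_add' g h := by
    obtain ⟨u, hu, rfl⟩ := HolGerm.exists_of g
    obtain ⟨v, hv, rfl⟩ := HolGerm.exists_of h
    rfl

theorem HolGerm.ev_of {p : ℂ × ℂ} {u : ℂ × ℂ → ℂ} (hu : AnalyticAt ℂ u p) :
    HolGerm.ev p (HolGerm.of u hu) = u p := rfl

/-- The partial derivative of a function in direction `v`. -/
noncomputable def pd (v : ℂ × ℂ) (u : ℂ × ℂ → ℂ) (q : ℂ × ℂ) : ℂ := fderiv ℂ u q v

theorem analyticAt_pd {v p : ℂ × ℂ} {u : ℂ × ℂ → ℂ} (hu : AnalyticAt ℂ u p) :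
    AnalyticAt ℂ (pd v u) p :=
  (ContinuousLinearMap.analyticAt (ContinuousLinearMap.apply ℂ ℂ v) _).comp hu.fderiv

theorem derivOp_of {p v : ℂ × ℂ} {u : ℂ × ℂ → ℂ} (hu : AnalyticAt ℂ u p) :
    derivOp p v (HolGerm.of u hu) = HolGerm.of (pd v u) (analyticAt_pd hu) := rfl

theorem derivOp_mul (p v : ℂ × ℂ) (g h : HolGerm p) :
    derivOp p v (g * h) = derivOp p v g * h + g * derivOp p v h := by
  obtain ⟨u, hu, rfl⟩ := HolGerm.exists_of g
  obtain ⟨w, hw, rfl⟩ := HolGerm.exists_of h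
  simp only [HolGerm.of_mul, derivOp_of, HolGerm.of_add]
  rw [HolGerm.of_eq_of]
  filter_upwards [hu.eventually_analyticAt, hw.eventually_analyticAt] with q h1 h2
  have := fderiv_fun_mul h1.differentiableAt h2.differentiableAt
  simp only [pd, this, add_apply, smul_apply, smul_eq_mul]
  ring

theorem derivOp_comm (p v w : ℂ × ℂ) (g : HolGerm p) :
    derivOp p v (derivOp p w g) = derivOp p w (derivOp p v g) := by
  obtain ⟨u, hu, rfl⟩ := HolGerm.exists_of g
  simp only [derivOp_of]
  rw [HolGerm.of_eq_of]
  filter_upwards [hu.eventually_analyticAt] with q h1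
  have h2 : DifferentiableAt ℂ (fderiv ℂ u) q := h1.fderiv.differentiableAt
  have key := second_derivative_symmetric_of_eventually (𝕜 := ℂ) (f := u) (f' := fderiv ℂ u)
    (x := q) (h1.eventually_analyticAt.mono fun z hz => hz.differentiableAt.hasFDerivAt)
    h2.hasFDerivAt v w
  have e : ∀ a b : ℂ × ℂ, pd a (pd b u) q = fderiv ℂ (fderiv ℂ u) q a b := by
    intro a b
    have : HasFDerivAt (pd b u) ((ContinuousLinearMap.apply ℂ ℂ b).comp
        (fderiv ℂ (fderiv ℂ u) q)) q :=
      (ContinuousLinearMap.hasFDerivAt (ContinuousLinearMap.apply ℂ ℂ b)).comp q h2.hasFDerivAt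
    rw [pd, this.fderiv]
    rfl
  rw [e, e, key]

theorem derivOp_const (p v : ℂ × ℂ) (c : ℂ) : derivOp p v (HolGerm.const p c) = 0 := by
  rw [HolGerm.const, derivOp_of]
  change _ = HolGerm.of (fun _ => 0) analyticAt_const
  refine HolGerm.of_eq_of.2 (Eventually.of_forall fun q => ?_)
  simp [pd]

theorem derivOp_one (p v : ℂ × ℂ) : derivOp p v 1 = 0 := derivOp_const p v 1

theorem derivOp_natCast (p v : ℂ × ℂ) (n : ℕ) : derivOp p v (n : HolGerm p) = 0 := by
  induction n with
  | zero => simp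
  | succ n ih => rw [Nat.cast_succ, map_add, ih, derivOp_one, add_zero]

theorem derivOp_ofNat (p v : ℂ × ℂ) (n : ℕ) [n.AtLeastTwo] :
    derivOp p v (ofNat(n) : HolGerm p) = 0 := derivOp_natCast p v n

theorem derivOp_pow (p v : ℂ × ℂ) (g : HolGerm p) (n : ℕ) :
    derivOp p v (g ^ n) = n * g ^ (n - 1) * derivOp p v g := by
  induction n with
  | zero => simp [derivOp_one]
  | succ n ih =>
    rw [pow_succ, derivOp_mul, ih]
    cases n with
    | zero => simp
    | succ n => simp only [Nat.add_sub_cancel]; push_cast; ring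

/-- The germ of the coordinate `lam`. -/
noncomputable def lamG (p : ℂ × ℂ) : HolGerm p := HolGerm.of Prod.fst analyticAt_fst

/-- The germ of the coordinate `mu`. -/
noncomputable def muG (p : ℂ × ℂ) : HolGerm p := HolGerm.of Prod.snd analyticAt_snd

theorem lamOp_apply (p : ℂ × ℂ) (g : HolGerm p) : lamOp p g = lamG p * g := rfl

theorem muOp_apply (p : ℂ × ℂ) (g : HolGerm p) : muOp p g = muG p * g := rfl

/-- Partial derivative of germs along the first coordinate. -/
noncomputable def dl (p : ℂ × ℂ) : Module.End ℂ (HolGerm p) := derivOp p (1, 0)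

/-- Partial derivative of germs along the second coordinate. -/
noncomputable def dm (p : ℂ × ℂ) : Module.End ℂ (HolGerm p) := derivOp p (0, 1)

theorem thetaLam_apply (p : ℂ × ℂ) (g : HolGerm p) : thetaLam p g = lamG p * dl p g := rfl

theorem thetaMu_apply (p : ℂ × ℂ) (g : HolGerm p) : thetaMu p g = muG p * dm p g := rfl

theorem derivOp_lamG (p v : ℂ × ℂ) : derivOp p v (lamG p) = HolGerm.const p v.1 := by
  rw [lamG, derivOp_of, HolGerm.const]
  refine HolGerm.of_eq_of.2 (Eventually.of_forall fun q => ?_)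
  simp [pd, fderiv_fst]

theorem derivOp_muG (p v : ℂ × ℂ) : derivOp p v (muG p) = HolGerm.const p v.2 := by
  rw [muG, derivOp_of, HolGerm.const]
  refine HolGerm.of_eq_of.2 (Eventually.of_forall fun q => ?_)
  simp [pd, fderiv_snd]

variable (p : ℂ × ℂ)

theorem dl_lamG : dl p (lamG p) = 1 := derivOp_lamG p _
theorem dm_lamG : dm p (lamG p) = 0 := derivOp_lamG p _
theorem dl_muG : dl p (muG p) = 0 := derivOp_muG p _
theorem dm_muG : dm p (muG p) = 1 := derivOp_muG p _
theorem dl_mul (g h : HolGerm p) : dl p (g * h) = dl p g * h + g * dl p h := derivOp_mul p _ g h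
theorem dm_mul (g h : HolGerm p) : dm p (g * h) = dm p g * h + g * dm p h := derivOp_mul p _ g h
theorem dl_const (c : ℂ) : dl p (HolGerm.const p c) = 0 := derivOp_const p _ c
theorem dm_const (c : ℂ) : dm p (HolGerm.const p c) = 0 := derivOp_const p _ c
theorem dl_one : dl p 1 = 0 := derivOp_one p _
theorem dm_one : dm p 1 = 0 := derivOp_one p _
theorem dl_ofNat (n : ℕ) [n.AtLeastTwo] : dl p (ofNat(n) : HolGerm p) = 0 := derivOp_ofNat p _ n
theorem dm_ofNat (n : ℕ) [n.AtLeastTwo] : dm p (ofNat(n) : HolGerm p) = 0 := derivOp_ofNat p _ n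
theorem dl_pow (g : HolGerm p) (n : ℕ) : dl p (g ^ n) = n * g ^ (n - 1) * dl p g :=
  derivOp_pow p _ g n
theorem dm_pow (g : HolGerm p) (n : ℕ) : dm p (g ^ n) = n * g ^ (n - 1) * dm p g :=
  derivOp_pow p _ g n
theorem dm_dl (g : HolGerm p) : dm p (dl p g) = dl p (dm p g) := derivOp_comm p _ _ g

end PeriodDE

/-! ### The operators in partial derivatives, their syzygy, and the resultant of their symbols. -/

namespace PeriodDE

/-- Coefficients of `D1` with respect to the partial derivatives of order at most two. -/
def coefD1 {R : Type*} [CommRing R] (_c l m : R) (j : Fin 4) : Fin 6 → R :=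
  match j with
  | 0 => ![-2 * l,
      l - 10 * l ^ 2,
      -40 * l * m,
      l ^ 2 - 4 * l ^ 3,
      2 * l * m - 20 * l ^ 2 * m,
      -25 * l * m ^ 2]
  | 1 => ![0,
      -l * m,
      l * m,
      -l ^ 2 * m,
      0,
      l * m ^ 2]
  | 2 => ![0,
      4 * l * m,
      l * m,
      3 * l ^ 2 * m,
      4 * l * m ^ 2,
      l * m ^ 2]
  | 3 => ![-2 * m,
      -18 * l * m,
      m - 10 * m ^ 2,
      -9 * l ^ 2 * m,
      -12 * l * m ^ 2,
      m ^ 2 - 4 * m ^ 3]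

/-- Coefficients of `D3` with respect to the partial derivatives of order at most two. -/
def coefD3 {R : Type*} [CommRing R] (c l m : R) (j : Fin 4) : Fin 6 → R :=
  match j with
  | 0 => ![-8 * l ^ 3,
      4 * l ^ 3 - 40 * l ^ 4,
      5 * l ^ 2 * m - 40 * l ^ 3 * m,
      25 * l ^ 2 * m + 4 * l ^ 4 - 16 * l ^ 5,
      -2 * l ^ 3 * m - 40 * l ^ 4 * m,
      5 * l ^ 2 * m ^ 2]
  | 1 => ![6 * c * l,
      c * l + 2 * l ^ 2,
      2 * l * m,
      c * l ^ 2 + l ^ 3,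
      2 * l ^ 2 * m,
      l * m ^ 2]
  | 2 => ![18 * l ^ 2,
      3 * l ^ 2 + 162 * l ^ 3,
      252 * l ^ 2 * m,
      -l ^ 2 * m + 3 * l ^ 3 + 81 * l ^ 4,
      2 * l ^ 2 * m + 216 * l ^ 3 * m,
      144 * l ^ 2 * m ^ 2]
  | 3 => ![18 * l,
      3 * l + 16 * l * m + 162 * l ^ 2,
      90 * l * m,
      3 * l ^ 2 + 12 * l ^ 2 * m + 81 * l ^ 3,
      -2 * l * m + 8 * l * m ^ 2 + 108 * l ^ 2 * m,
      36 * l * m ^ 2]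

/-- The partial derivatives of order at most two of a germ. -/
noncomputable def jetG (p : ℂ × ℂ) (g : HolGerm p) : Fin 6 → HolGerm p :=
  ![g, dl p g, dm p g, dl p (dl p g), dl p (dm p g), dm p (dm p g)]

/-- The second order operator with coefficients `a`. -/
noncomputable def opG (p : ℂ × ℂ) (a : Fin 6 → HolGerm p) (g : HolGerm p) : HolGerm p :=
  ∑ k, a k * jetG p g k

theorem D1_apply (p : ℂ × ℂ) (j : Fin 4) (g : HolGerm p) :
    D1 p j g = opG p (coefD1 (HolGerm.const p (1 / 27)) (lamG p) (muG p) j) g := by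
  fin_cases j <;>
  · simp [D1, opG, jetG, coefD1, Fin.sum_univ_succ, Module.End.mul_apply, pow_two, thetaLam_apply,
      thetaMu_apply, lamOp_apply, muOp_apply, dl_mul, dm_mul, dl_lamG, dm_lamG, dl_muG, dm_muG,
      dm_dl, dl_ofNat, dm_ofNat, Module.End.ofNat_apply]
    ring

theorem D3_apply (p : ℂ × ℂ) (j : Fin 4) (g : HolGerm p) :
    D3 p j g = opG p (coefD3 (HolGerm.const p (1 / 27)) (lamG p) (muG p) j) g := by
  -- Since 2/9 = 6/27, the single constant `c = 1/27` is enough to write every coefficient over an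
  -- arbitrary commutative ring.
  have h9 : HolGerm.const p (2 / 9) = 6 * HolGerm.const p (1 / 27) := by
    rw [show (6 : HolGerm p) = HolGerm.const p 6 from (HolGerm.const_ofNat p 6).symm,
      HolGerm.const_mul_const]
    norm_num
  fin_cases j <;>
  · simp [D3, opG, jetG, coefD3, Fin.sum_univ_succ, Module.End.mul_apply, pow_succ, thetaLam_apply,
      thetaMu_apply, lamOp_apply, muOp_apply, dl_mul, dm_mul, dl_lamG, dm_lamG, dl_muG, dm_muG,
      dm_dl, dl_ofNat, dm_ofNat, Module.End.ofNat_apply, HolGerm.smul_eq_const_mul, h9,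
      -one_div]
    ring

/-- Partial derivatives of a germ which vanishes to first order contribute nothing to first order
terms at the base point. -/
def FlatAt (p : ℂ × ℂ) (g : HolGerm p) : Prop :=
  HolGerm.ev p g = 0 ∧ HolGerm.ev p (dl p g) = 0 ∧ HolGerm.ev p (dm p g) = 0

theorem FlatAt.ev_eq_zero {p : ℂ × ℂ} {g : HolGerm p} (h : FlatAt p g) (x y z : HolGerm p) :
    HolGerm.ev p (x * dl p g + y * dm p g + z * g) = 0 := by
  simp [h.1, h.2.1, h.2.2]

/-- The commutator of the two operators has order three, and here it is a combination of first-order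
operators applied to `D1 g` and `D3 g`. This is the integrability of the system: differentiating the
two equations produces no further condition. -/
theorem syzygy (p : ℂ × ℂ) (j : Fin 4) (g : HolGerm p) : ∃ x y z x' y' z' : HolGerm p,
    D3 p j (D1 p j g) + (x * dl p (D1 p j g) + y * dm p (D1 p j g) + z * D1 p j g) =
      D1 p j (D3 p j g) + (x' * dl p (D3 p j g) + y' * dm p (D3 p j g) + z' * D3 p j g) := by
  simp only [D1_apply, D3_apply]
  set c := HolGerm.const p (1 / 27)
  have hcl : dl p c = 0 := dl_const p _
  have hcm : dm p c = 0 := dm_const p _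
  have hc : 27 * c = 1 := by
    rw [← HolGerm.const_ofNat p 27, HolGerm.const_mul_const]
    norm_num
    rfl
  set l := lamG p with hl
  set m := muG p with hm
  have h1 : dl p l = 1 := dl_lamG p
  have h2 : dm p l = 0 := dm_lamG p
  have h3 : dl p m = 0 := dl_muG p
  have h4 : dm p m = 1 := dm_muG p
  clear_value c l m
  fin_cases j
  -- In each case `x`, `x'` are multiples of `l` and `y`, `y'` of `m`: the corrections are
  -- first-order operators in the Euler fields. The third-order terms of the commutator determine
  -- these four coefficients, the lower terms determine `z` and `z'`.
  · refine ⟨(-50 * m + 16 * l ^ 3) * l, 40 * l ^ 3 * m, 50 * m + 8 * l ^ 3,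
      (-4 + 20 * l) * l, (-4 + 50 * l) * m, 4 - 10 * l, ?_⟩
    simp [opG, jetG, coefD1, coefD3, Fin.sum_univ_succ, dl_mul, dm_mul, dl_pow, dm_pow, h1, h2, h3,
      h4, dm_dl, dl_ofNat, dm_ofNat, dl_one]
    ring
  · refine ⟨(-2 * c - 2 * l) * l, -2 * l * m, c, 2 * m * l, 0, -m, ?_⟩
    simp [opG, jetG, coefD1, coefD3, Fin.sum_univ_succ, dl_mul, dm_mul, dl_pow, dm_pow, h1, h2, h3,
      h4, dm_dl, dl_ofNat, dm_ofNat, hcl, hcm]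
    ring
  · refine ⟨(2 * m - 6 * l - 162 * l ^ 2) * l, (-2 * l - 216 * l ^ 2) * m, -2 * m + 3 * l,
      -10 * m * l, -8 * m * m, 6 * m, ?_⟩
    simp [opG, jetG, coefD1, coefD3, Fin.sum_univ_succ, dl_mul, dm_mul, dl_pow, dm_pow, h1, h2, h3,
      h4, dm_dl, dl_ofNat, dm_ofNat]
    ring
  · refine ⟨0, 0, 0, 6 * m * l, 4 * m * m, 2 * m, ?_⟩
    simp [opG, jetG, coefD1, coefD3, Fin.sum_univ_succ, dl_mul, dm_mul, dl_pow, dm_pow, h1, h2, h3,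
      h4, dm_dl, dl_ofNat, dm_ofNat, dl_one, dm_one]
    ring

/-- At a point where `D1 g` and `D3 g` vanish to first order, the first-order corrections of
`syzygy` drop out. This is the only form in which the syzygy is used later. -/
theorem ev_D3_D1 (p : ℂ × ℂ) (j : Fin 4) (g : HolGerm p) (h1 : FlatAt p (D1 p j g))
    (h3 : FlatAt p (D3 p j g)) :
    HolGerm.ev p (D3 p j (D1 p j g)) = HolGerm.ev p (D1 p j (D3 p j g)) := by
  obtain ⟨x, y, z, x', y', z', h⟩ := syzygy p j g
  have := congrArg (HolGerm.ev p) h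
  rwa [RingHom.map_add _ (D3 p j (D1 p j g)), RingHom.map_add _ (D1 p j (D3 p j g)),
    h1.ev_eq_zero, h3.ev_eq_zero, add_zero, add_zero] at this

/-- The resultant of the principal symbols of the operators with coefficients `a` and `b`. -/
def symbolRes {R : Type*} [CommRing R] (a b : Fin 6 → R) : R :=
  (a 3 * b 5 - a 5 * b 3) ^ 2 - (a 3 * b 4 - a 4 * b 3) * (a 4 * b 5 - a 5 * b 4)

/-- The discriminant polynomial enters the proof only here: the resultant of the symbols equals a
nonzero constant times a monomial in `l`, `m` times `discr j`. -/
theorem symbolRes_ne_zero (j : Fin 4) {q : ℂ × ℂ} (hq : q ∈ Lambda j) :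
    symbolRes (coefD1 (1 / 27) q.1 q.2 j) (coefD3 (1 / 27) q.1 q.2 j) ≠ 0 := by
  obtain ⟨l, m⟩ := q
  have h : l * m * discr j (l, m) ≠ 0 := hq
  obtain ⟨h12, h3⟩ := mul_ne_zero_iff.1 h
  obtain ⟨h1, h2⟩ := mul_ne_zero_iff.1 h12
  fin_cases j
  · have : symbolRes (coefD1 (1 / 27) l m 0) (coefD3 (1 / 27) l m 0) =
        -125 * l ^ 6 * m ^ 4 * discr 0 (l, m) := by
      simp [symbolRes, coefD1, coefD3, discr]
      ring
    change symbolRes (coefD1 (1 / 27) l m 0) (coefD3 (1 / 27) l m 0) ≠ 0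
    rw [this]
    exact mul_ne_zero (by simp [h1, h2]) h3
  · have : symbolRes (coefD1 (1 / 27) l m 1) (coefD3 (1 / 27) l m 1) =
        1 / 729 * l ^ 6 * m ^ 4 * discr 1 (l, m) := by
      simp [symbolRes, coefD1, coefD3, discr]
      ring
    change symbolRes (coefD1 (1 / 27) l m 1) (coefD3 (1 / 27) l m 1) ≠ 0
    rw [this]
    exact mul_ne_zero (by simp [h1, h2]) h3
  · have : symbolRes (coefD1 (1 / 27) l m 2) (coefD3 (1 / 27) l m 2) =
        9 * l ^ 6 * m ^ 4 * discr 2 (l, m) := by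
      simp [symbolRes, coefD1, coefD3, discr]
      ring
    change symbolRes (coefD1 (1 / 27) l m 2) (coefD3 (1 / 27) l m 2) ≠ 0
    rw [this]
    exact mul_ne_zero (by simp [h1, h2]) h3
  · have : symbolRes (coefD1 (1 / 27) l m 3) (coefD3 (1 / 27) l m 3) =
        9 * l ^ 4 * m ^ 4 * discr 3 (l, m) := by
      simp [symbolRes, coefD1, coefD3, discr]
      ring
    change symbolRes (coefD1 (1 / 27) l m 3) (coefD3 (1 / 27) l m 3) ≠ 0
    rw [this]
    exact mul_ne_zero (by simp [h1, h2]) h3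

end PeriodDE

namespace PeriodDE

/-! ### Linear differential equations along rays, depending analytically on the direction -/

section Ray

variable {E V W : Type*} [NormedAddCommGroup E] [NormedSpace ℂ E]
  [NormedAddCommGroup V] [NormedSpace ℂ V] [NormedAddCommGroup W] [NormedSpace ℂ W]

/-- Bounded operators between normed spaces, with the structure induced by the norms. -/
abbrev BoundedOp (X Y : Type*) [NormedAddCommGroup X] [NormedSpace ℂ X] [NormedAddCommGroup Y]
    [NormedSpace ℂ Y] := X →L[ℂ] Y

/-- Primitive vanishing at `0` of a continuous function on the unit interval. -/
noncomputable def volterra (V : Type*) [NormedAddCommGroup V] [NormedSpace ℂ V]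
    [CompleteSpace V] : BoundedOp C(unitInterval, V) C(unitInterval, V) :=
  LinearMap.mkContinuous
    { toFun := fun f => ⟨fun t => ∫ s in (0 : ℝ)..t, f (Set.projIcc 0 1 zero_le_one s),
        (intervalIntegral.continuous_primitive (fun a b =>
          (f.continuous.comp continuous_projIcc).intervalIntegrable a b) 0).comp
            continuous_subtype_val⟩
      map_add' := fun f g => by
        ext t
        exact intervalIntegral.integral_add
          ((f.continuous.comp continuous_projIcc).intervalIntegrable _ _)
          ((g.continuous.comp continuous_projIcc).intervalIntegrable _ _)
      map_smul' := fun c f => by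
        ext t
        exact intervalIntegral.integral_smul c _ }
    1 (fun f => by
      rw [one_mul, ContinuousMap.norm_le _ (norm_nonneg f)]
      intro t
      refine (intervalIntegral.norm_integral_le_of_norm_le_const
        (C := ‖f‖) fun s _ => f.norm_coe_le_norm _).trans ?_
      rw [sub_zero, abs_of_nonneg t.2.1]
      exact mul_le_of_le_one_right (norm_nonneg f) t.2.2)

/-- Pointwise application of a continuous family of operators to a continuous family of vectors. -/
noncomputable def pointwiseApply (V W : Type*) [NormedAddCommGroup V] [NormedSpace ℂ V]
    [NormedAddCommGroup W] [NormedSpace ℂ W] :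
    BoundedOp C(unitInterval, BoundedOp V W)
      (BoundedOp C(unitInterval, V) C(unitInterval, W)) :=
  LinearMap.mkContinuous₂
    (LinearMap.mk₂ ℂ
      (fun (A : C(unitInterval, V →L[ℂ] W)) (f : C(unitInterval, V)) =>
        (⟨fun t => A t (f t), A.continuous.clm_apply f.continuous⟩ : C(unitInterval, W)))
      (fun A B f => by ext t; simp) (fun c A f => by ext t; simp)
      (fun A f g => by ext t; simp) (fun c A f => by ext t; simp))
    1 (fun A f => by
      rw [one_mul, ContinuousMap.norm_le _ (by positivity)]
      intro t
      exact (A t).le_of_opNorm_le_of_le (A.norm_coe_le_norm t) (f.norm_coe_le_norm t))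

theorem pointwiseApply_apply (A : C(unitInterval, V →L[ℂ] W)) (f : C(unitInterval, V))
    (t : unitInterval) : pointwiseApply V W A f t = A t (f t) := rfl

/-- Multiplication of a constant by the `k`-th power of the coordinate of the unit interval. -/
noncomputable def powSmul (W : Type*) [NormedAddCommGroup W] [NormedSpace ℂ W] (k : ℕ) :
    BoundedOp W C(unitInterval, W) :=
  LinearMap.mkContinuous
    { toFun := fun w => ⟨fun t => ((t : ℝ) : ℂ) ^ k • w, by fun_prop⟩
      map_add' := fun f g => by ext t; exact smul_add _ _ _
      map_smul' := fun c f => by ext t; exact smul_comm _ _ _ }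
    1 (fun w => by
      rw [one_mul, ContinuousMap.norm_le _ (norm_nonneg w)]
      intro t
      change ‖((t : ℝ) : ℂ) ^ k • w‖ ≤ ‖w‖
      rw [norm_smul, norm_pow, Complex.norm_real, Real.norm_of_nonneg t.2.1]
      exact mul_le_of_le_one_left (norm_nonneg w) (pow_le_one₀ t.2.1 t.2.2))

theorem powSmul_apply (k : ℕ) (w : W) (t : unitInterval) :
    powSmul W k w t = ((t : ℝ) : ℂ) ^ k • w := rfl

theorem norm_powSmul_le (k : ℕ) : ‖powSmul W k‖ ≤ 1 :=
  LinearMap.mkContinuous_norm_le _ zero_le_one _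

/-- The power series of the restriction to rays of a function with power series `P`. -/
noncomputable def raySeries (P : FormalMultilinearSeries ℂ E W) :
    FormalMultilinearSeries ℂ E C(unitInterval, W) := fun k =>
  (powSmul W k).compContinuousMultilinearMap (P k)

theorem raySeries_apply (P : FormalMultilinearSeries ℂ E W) (n : ℕ) (v : E) (t : unitInterval) :
    (raySeries P n fun _ => v) t = P n fun _ => ((t : ℝ) : ℂ) • v := by
  rw [(P n).map_smul_univ (fun _ => ((t : ℝ) : ℂ)) (fun _ => v)]
  simp only [Finset.prod_const, Finset.card_univ, Fintype.card_fin]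
  rfl

/-- Restricting to rays multiplies the degree `k` term by the function `t ^ k`, whose sup norm on
the unit interval is at most 1. -/
theorem radius_le_raySeries (P : FormalMultilinearSeries ℂ E W) :
    P.radius ≤ (raySeries P).radius := by
  have hQP : ∀ k, ‖raySeries P k‖ ≤ ‖P k‖ := fun k =>
    ((powSmul W k).norm_compContinuousMultilinearMap_le (P k)).trans
      (mul_le_of_le_one_left (norm_nonneg (P k)) (norm_powSmul_le k))
  refine ENNReal.le_of_forall_nnreal_lt fun s hs => ?_
  obtain ⟨C, hC0, hC⟩ := P.norm_mul_pow_le_of_lt_radius hs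
  exact (raySeries P).le_radius_of_bound C fun n =>
    (mul_le_mul_of_nonneg_right (hQP n) (by positivity)).trans (hC n)

theorem smul_mem_eball (v : E) (r : ENNReal) (t : unitInterval) (hv : v ∈ Metric.eball (0 : E) r) :
    ((t : ℝ) : ℂ) • v ∈ Metric.eball (0 : E) r := by
  rw [mem_eball_zero_iff] at hv ⊢
  refine lt_of_le_of_lt ?_ hv
  rw [enorm_smul]
  refine mul_le_of_le_one_left' ?_
  rw [← enorm_norm, Complex.norm_real, Real.norm_of_nonneg t.2.1, Real.enorm_of_nonneg t.2.1]
  exact ENNReal.ofReal_le_one.2 t.2.2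

theorem hasSum_eval {ι : Type*} {g : ι → C(unitInterval, W)} {G : C(unitInterval, W)}
    (h : HasSum g G) (t : unitInterval) : HasSum (fun i => g i t) (G t) :=
  (ContinuousMap.evalCLM ℂ t).hasSum h

theorem hasSum_raySeries_apply (P : FormalMultilinearSeries ℂ E W) (v : E)
    (G : C(unitInterval, W)) (t : unitInterval) (h : HasSum (fun n => raySeries P n fun _ => v) G) :
    HasSum (fun n => P n fun _ => ((t : ℝ) : ℂ) • v) (G t) := by
  have h2 := hasSum_eval h t
  simpa only [raySeries_apply] using h2

theorem raySeries_sum_apply [CompleteSpace W] {f : E → W} {p : E}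
    {P : FormalMultilinearSeries ℂ E W} {r : ENNReal} (hP : HasFPowerSeriesOnBall f P p r) {v : E}
    (hv : v ∈ Metric.eball 0 r) (t : unitInterval) :
    (raySeries P).sum v t = f (p + ((t : ℝ) : ℂ) • v) := by
  have hle : r ≤ (raySeries P).radius := hP.r_le.trans (radius_le_raySeries P)
  have hQ := (raySeries P).hasFPowerSeriesOnBall (hP.r_pos.trans_le hle)
  have h1 : HasSum (fun n => raySeries P n fun _ => v) ((raySeries P).sum (0 + v)) :=
    hQ.hasSum (Metric.eball_subset_eball hle hv)
  rw [zero_add] at h1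
  have h2 := hasSum_raySeries_apply P v _ t h1
  have h3 : HasSum (fun n => P n fun _ => ((t : ℝ) : ℂ) • v) (f (p + ((t : ℝ) : ℂ) • v)) :=
    hP.hasSum (smul_mem_eball v r t hv)
  exact h2.unique h3

/-- Restriction of an analytic function to rays is an analytic function of the direction. -/
theorem exists_analyticAt_ray [CompleteSpace W] {f : E → W} {p : E} (hf : AnalyticAt ℂ f p) :
    ∃ Φ : E → C(unitInterval, W), AnalyticAt ℂ Φ 0 ∧
      ∀ᶠ v in 𝓝 (0 : E), ∀ t : unitInterval, Φ v t = f (p + ((t : ℝ) : ℂ) • v) := by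
  obtain ⟨P, r, hP⟩ := hf
  have hle : r ≤ (raySeries P).radius := hP.r_le.trans (radius_le_raySeries P)
  have hQ := (raySeries P).hasFPowerSeriesOnBall (hP.r_pos.trans_le hle)
  exact ⟨(raySeries P).sum, hQ.analyticAt, eventually_of_mem (Metric.eball_mem_nhds 0 hP.r_pos)
    fun v hv t => raySeries_sum_apply hP hv t⟩

end Ray

end PeriodDE

/-! ### The radial differential equation, solved with analytic dependence on the direction. -/

namespace PeriodDE

section RayODE

variable {E V : Type*} [NormedAddCommGroup E] [NormedSpace ℂ E]
  [NormedAddCommGroup V] [NormedSpace ℂ V] [CompleteSpace V]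

section Abstract

variable {X Y Z : Type*} [NormedAddCommGroup X] [NormedSpace ℂ X] [NormedAddCommGroup Y]
  [NormedSpace ℂ Y] [NormedAddCommGroup Z] [NormedSpace ℂ Z]

theorem analyticAt_op_apply (B : BoundedOp X Y) {f : E → X} {v : E} (hf : AnalyticAt ℂ f v) :
    AnalyticAt ℂ (fun w => B (f w)) v :=
  (B.analyticAt (f v)).comp hf

theorem analyticAt_op_comp (J : BoundedOp Y Z) {B : E → BoundedOp X Y} {v : E}
    (hB : AnalyticAt ℂ B v) : AnalyticAt ℂ (fun w => (J.comp (B w) : BoundedOp X Z)) v :=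
  ((ContinuousLinearMap.compL ℂ X Y Z J).analyticAt (B v)).comp hB

theorem analyticAt_apply_apply {B : E → BoundedOp X Y} {f : E → X} {v : E}
    (hB : AnalyticAt ℂ B v) (hf : AnalyticAt ℂ f v) : AnalyticAt ℂ (fun w => B w (f w)) v :=
  AnalyticAt.comp (g := fun x : (X →L[ℂ] Y) × X => x.1 x.2) (f := fun w => (B w, f w))
    ((ContinuousLinearMap.id ℂ (X →L[ℂ] Y)).analyticAt_bilinear (B v, f v)) (hB.prod hf)

theorem comp_map_zero (J : BoundedOp Y Z) (B : BoundedOp E (BoundedOp X Y)) :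
    J.comp (B 0) = 0 := by
  rw [map_zero, ContinuousLinearMap.comp_zero]

/-- Near `0` the operator `1 - T v` is invertible because `T 0 = 0`, and inversion is analytic at
units. The inverse gives existence, uniqueness and analytic dependence on `v` at once. -/
theorem exists_analytic_fixedPoint [CompleteSpace X] {T : E → BoundedOp X X}
    (hT : AnalyticAt ℂ T 0) (hT0 : T 0 = 0) (c : X) :
    ∃ γ : E → X, AnalyticAt ℂ γ 0 ∧ γ 0 = c ∧
      ∀ᶠ v in 𝓝 (0 : E), γ v - T v (γ v) = c ∧ ∀ f, f - T v f = c → f = γ v := by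
  have h1 : AnalyticAt ℂ (fun v => 1 - T v) 0 := analyticAt_const.sub hT
  have h2 : AnalyticAt ℂ Ring.inverse (1 - T 0) := by
    rw [hT0, sub_zero]
    exact analyticAt_inverse (𝕜 := ℂ) (1 : (X →L[ℂ] X)ˣ)
  refine ⟨fun v => Ring.inverse (1 - T v) c,
    analyticAt_apply_apply (h2.comp_of_eq h1 rfl) analyticAt_const, ?_, ?_⟩
  · simp [hT0]
  have hunit : ∀ᶠ v in 𝓝 (0 : E), IsUnit (1 - T v) := by
    refine h1.continuousAt.eventually_mem (Units.isOpen.mem_nhds ?_)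
    simp [hT0]
  filter_upwards [hunit] with v hv
  constructor
  · have := congrArg (fun A => A c) (Ring.mul_inverse_cancel _ hv)
    simpa using this
  · intro f hf
    have h2 := congrArg (fun A => A f) (Ring.inverse_mul_cancel _ hv)
    have h3 : (1 - T v) f = c := by simpa using hf
    have h4 : Ring.inverse (1 - T v) ((1 - T v) f) = f := by simpa using h2
    rw [← h4, h3]

end Abstract

/-- For each direction `v` the linear ODE along `p + t v` is an integral equation in `C([0,1], V)`,
solved by a path `γ v` analytic in `v`. The solution at `q` is the endpoint of the path `γ (q - p)`.
Only the radial derivative is controlled here; the other directions need vanishing curvature. -/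
theorem exists_radial_solution {Ω : E → E →L[ℂ] V →L[ℂ] V} {p : E}
    (hΩ : AnalyticAt ℂ Ω p)
    (U₀ : V) : ∃ F : E → V, AnalyticAt ℂ F p ∧ F p = U₀ ∧
      ∀ᶠ q in 𝓝 p, fderiv ℂ F q (q - p) = Ω q (q - p) (F q) := by
  obtain ⟨Φ, hΦ, hΦe⟩ := exists_analyticAt_ray hΩ
  -- The exponent `0` makes `cst v` the constant path `v`, so that `ω v` is the path `t ↦ Ω (p + t
  -- v) v`.
  let cst : BoundedOp E C(unitInterval, E) := powSmul E 0
  let ω : E → C(unitInterval, V →L[ℂ] V) := fun v => pointwiseApply E (BoundedOp V V) (Φ v) (cst v)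
  have hω : AnalyticAt ℂ ω 0 :=
    analyticAt_apply_apply (analyticAt_op_apply (pointwiseApply E (BoundedOp V V)) hΦ)
      (cst.analyticAt 0)
  let T : E → BoundedOp C(unitInterval, V) C(unitInterval, V) := fun v =>
    (volterra V).comp (pointwiseApply V V (ω v))
  have hT : AnalyticAt ℂ T 0 :=
    analyticAt_op_comp (volterra V) (analyticAt_op_apply (pointwiseApply V V) hω)
  have hT0 : T 0 = 0 := by
    have : ω 0 = 0 := by simp [ω]
    change (volterra V).comp (pointwiseApply V V (ω 0)) = 0
    rw [this]
    exact comp_map_zero _ _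
  obtain ⟨γ, hγ, hγ0, hγe⟩ := exists_analytic_fixedPoint hT hT0 (powSmul V 0 U₀)
  let one' : unitInterval := 1
  let F : E → V := fun q => γ (q - p) one'
  have hsub : AnalyticAt ℂ (fun q : E => q - p) p := analyticAt_id.sub analyticAt_const
  have hF : AnalyticAt ℂ F p := by
    have h1 : AnalyticAt ℂ (fun q : E => γ (q - p)) p := hγ.comp_of_eq hsub (sub_self p)
    exact analyticAt_op_apply (ContinuousMap.evalCLM ℂ one') h1
  refine ⟨F, hF, ?_, ?_⟩
  · simp [F, hγ0, powSmul_apply]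
  -- properties of a direction that survive on the whole segment
  obtain ⟨r, hr, hball⟩ := Metric.eventually_nhds_iff_ball.1 (hγe.and hΦe)
  obtain ⟨r', hr', hball'⟩ := Metric.eventually_nhds_iff_ball.1 hF.eventually_analyticAt
  have hint : ∀ v ∈ Metric.ball (0 : E) r, ∀ t : unitInterval,
      γ v t = U₀ + ∫ s in (0 : ℝ)..t, ω v (Set.projIcc 0 1 zero_le_one s)
        (γ v (Set.projIcc 0 1 zero_le_one s)) := by
    intro v hv t
    have h1 := congrArg (fun f : C(unitInterval, V) => f t) (hball v hv).1.1
    simp only [ContinuousMap.sub_apply, powSmul_apply, pow_zero, one_smul] at h1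
    rw [← h1]
    exact (sub_add_cancel _ _).symm
  have hωval : ∀ v ∈ Metric.ball (0 : E) r, ∀ t : unitInterval,
      ω v t = Ω (p + ((t : ℝ) : ℂ) • v) v := by
    intro v hv t
    simp [ω, pointwiseApply_apply, (hball v hv).2 t, cst, powSmul_apply]
  have hscale : ∀ v ∈ Metric.ball (0 : E) r, ∀ τ : unitInterval,
      F (p + ((τ : ℝ) : ℂ) • v) = γ v τ := by
    intro v hv τ
    have hv' : ((τ : ℝ) : ℂ) • v ∈ Metric.ball (0 : E) r := by
      rw [mem_ball_zero_iff] at hv ⊢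
      rw [norm_smul, Complex.norm_real, Real.norm_of_nonneg τ.2.1]
      exact lt_of_le_of_lt (mul_le_of_le_one_left (norm_nonneg v) τ.2.2) hv
    -- The path `t ↦ γ v (τ t)` satisfies the integral equation for the direction `τ v`, by the
    -- substitution `s ↦ τ s`. Uniqueness identifies it with `γ (τ v)`, so the endpoint of the
    -- latter is `γ v τ`.
    let g : C(unitInterval, V) := (γ v).comp ⟨fun t => τ * t, by fun_prop⟩
    have hg : g = γ (((τ : ℝ) : ℂ) • v) := by
      refine (hball _ hv').1.2 _ ?_
      ext t
      let h : ℝ → V := fun x => ω v (Set.projIcc 0 1 zero_le_one x)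
            (γ v (Set.projIcc 0 1 zero_le_one x))
      have h1 : g t = γ v (τ * t) := rfl
      have h2 : T (((τ : ℝ) : ℂ) • v) g t =
          ∫ s in (0 : ℝ)..t, (τ : ℝ) • h ((τ : ℝ) * s) := by
        refine intervalIntegral.integral_congr fun s hs => ?_
        rw [Set.uIcc_of_le t.2.1] at hs
        have hs1 : s ∈ Set.Icc (0 : ℝ) 1 := ⟨hs.1, hs.2.trans t.2.2⟩
        have hs2 : (τ : ℝ) * s ∈ Set.Icc (0 : ℝ) 1 :=
          ⟨mul_nonneg τ.2.1 hs1.1, mul_le_one₀ τ.2.2 hs1.1 hs1.2⟩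
        change ω (((τ : ℝ) : ℂ) • v) (Set.projIcc 0 1 zero_le_one s)
          (g (Set.projIcc 0 1 zero_le_one s)) = _
        simp only [h]
        rw [Set.projIcc_of_mem _ hs1, Set.projIcc_of_mem _ hs2, hωval _ hv', hωval _ hv]
        have h3 : g ⟨s, hs1⟩ = γ v ⟨τ * s, hs2⟩ := rfl
        rw [h3]
        rw [map_smul, smul_apply, smul_smul, mul_comm, ← Complex.ofReal_mul, Complex.coe_smul]
      have h4 := intervalIntegral.smul_integral_comp_mul_left (a := 0) (b := t) h (τ : ℝ)
      rw [ContinuousMap.sub_apply, h1, h2, intervalIntegral.integral_smul, h4, mul_zero, hint v hv]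
      simp [powSmul_apply, h]
    change γ (p + ((τ : ℝ) : ℂ) • v - p) one' = _
    rw [add_sub_cancel_left, ← hg]
    change γ v (τ * 1) = _
    rw [mul_one]
  have hR : 0 < min (r / 2) r' := lt_min (half_pos hr) hr'
  filter_upwards [Metric.ball_mem_nhds p hR] with q hq
  set w := q - p with hw
  have hqw : q = p + w := by simp [hw]
  rw [Metric.mem_ball, dist_eq_norm, ← hw] at hq
  -- The direction is doubled so that `q` sits at the interior parameter `1/2`, where two-sided
  -- derivatives exist. This is why the radius was halved.
  have hv : (2 : ℂ) • w ∈ Metric.ball (0 : E) r := by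
    rw [mem_ball_zero_iff, norm_smul]
    have := hq.trans_le (min_le_left _ _)
    norm_num
    linarith
  have hFq : AnalyticAt ℂ F q := hball' q (by
    rw [Metric.mem_ball, dist_eq_norm, ← hw]; exact hq.trans_le (min_le_right _ _))
  -- differentiate along the ray at the midpoint
  have hd1 : HasDerivAt (fun τ : ℝ => F (p + (τ : ℂ) • (2 : ℂ) • w))
      (fderiv ℂ F q ((2 : ℂ) • w)) (1 / 2) := by
    have hray : HasDerivAt (fun τ : ℝ => p + (τ : ℂ) • (2 : ℂ) • w) ((2 : ℂ) • w) (1 / 2) := by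
      simpa using ((Complex.ofRealCLM.hasDerivAt (x := (1 / 2 : ℝ))).smul_const
        ((2 : ℂ) • w)).const_add p
    have hq2 : p + (((1 / 2 : ℝ) : ℝ) : ℂ) • (2 : ℂ) • w = q := by
      rw [smul_smul, hqw]; norm_num
    have h1 : HasFDerivAt F ((fderiv ℂ F q).restrictScalars ℝ)
        (p + (((1 / 2 : ℝ) : ℝ) : ℂ) • (2 : ℂ) • w) := by
      rw [hq2]
      exact hFq.differentiableAt.hasFDerivAt.restrictScalars ℝ
    exact h1.comp_hasDerivAt _ hray
  have hd2 : HasDerivAt (fun τ : ℝ => F (p + (τ : ℂ) • (2 : ℂ) • w))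
      (Ω q ((2 : ℂ) • w) (F q)) (1 / 2) := by
    let h : ℝ → V := fun s => ω ((2 : ℂ) • w) (Set.projIcc 0 1 zero_le_one s)
        (γ ((2 : ℂ) • w) (Set.projIcc 0 1 zero_le_one s))
    have hcont : Continuous h :=
      ((ω ((2 : ℂ) • w)).continuous.comp continuous_projIcc).clm_apply
        ((γ ((2 : ℂ) • w)).continuous.comp continuous_projIcc)
    have h1 : HasDerivAt (fun τ : ℝ => U₀ + ∫ s in (0 : ℝ)..τ, h s) (h (1 / 2)) (1 / 2) :=
      (intervalIntegral.integral_hasDerivAt_right (hcont.intervalIntegrable _ _)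
        (hcont.stronglyMeasurableAtFilter _ _) hcont.continuousAt).const_add _
    have hhalf : (1 / 2 : ℝ) ∈ Set.Icc (0 : ℝ) 1 := by norm_num
    have hq2 : p + (((1 / 2 : ℝ) : ℝ) : ℂ) • (2 : ℂ) • w = q := by
      rw [smul_smul, hqw]; norm_num
    have h2 : h (1 / 2) = Ω q ((2 : ℂ) • w) (F q) := by
      have h3 := hscale _ hv ⟨1 / 2, hhalf⟩
      have h4 := hωval _ hv ⟨1 / 2, hhalf⟩
      change F (p + (((1 / 2 : ℝ) : ℝ) : ℂ) • (2 : ℂ) • w) = _ at h3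
      change _ = Ω (p + (((1 / 2 : ℝ) : ℝ) : ℂ) • (2 : ℂ) • w) _ at h4
      rw [hq2] at h3 h4
      simp only [h]
      rw [Set.projIcc_of_mem _ hhalf, h4, h3]
    rw [← h2]
    refine h1.congr_of_eventuallyEq ?_
    filter_upwards [Icc_mem_nhds (show (0 : ℝ) < 1 / 2 by norm_num)
      (show (1 / 2 : ℝ) < 1 by norm_num)] with τ hτ
    have h3 := hscale _ hv ⟨τ, hτ⟩
    rw [hint _ hv] at h3
    exact h3
  have := hd1.unique hd2
  rw [map_smul, map_smul, smul_apply] at this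
  exact smul_right_injective V (two_ne_zero (α := ℂ)) this

end RayODE

end PeriodDE

namespace PeriodDE

/-! ### Frobenius integration of a connection which is flat on a subbundle -/

section Frobenius

variable {E V W : Type*} [NormedAddCommGroup E] [NormedSpace ℂ E]
  [NormedAddCommGroup V] [NormedSpace ℂ V] [NormedAddCommGroup W] [NormedSpace ℂ W]

theorem hasDerivAt_ray (p v : E) (t : ℝ) : HasDerivAt (fun τ : ℝ => p + (τ : ℂ) • v) v t := by
  simpa using ((Complex.ofRealCLM.hasDerivAt (x := t)).smul_const v).const_add p

theorem hasDerivAt_comp_ray {f : E → V} {f' : E →L[ℂ] V} {p v : E} {t : ℝ}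
    (hf : HasFDerivAt f f' (p + (t : ℂ) • v)) :
    HasDerivAt (fun τ : ℝ => f (p + (τ : ℂ) • v)) (f' v) t :=
by
  have h : HasFDerivAt f (f'.restrictScalars ℝ) (p + (t : ℂ) • v) := hf.restrictScalars ℝ
  exact h.comp_hasDerivAt t (hasDerivAt_ray p v t)

theorem ray_mem_ball {p v : E} {r : ℝ} (hv : ‖v‖ < r) {t : ℝ} (ht : t ∈ Set.Icc (0 : ℝ) 1) :
    p + (t : ℂ) • v ∈ Metric.ball p r := by
  rw [mem_ball_iff_norm, add_sub_cancel_left, norm_smul, Complex.norm_real,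
    Real.norm_of_nonneg ht.1]
  exact lt_of_le_of_lt (mul_le_of_le_one_left (norm_nonneg v) ht.2) hv

/-- A solution of a homogeneous linear differential equation on `[0, 1]` which vanishes at `0`
vanishes. -/
theorem eq_zero_of_linear_ode {g : ℝ → V} {N : ℝ → V →L[ℂ] V}
    (hN : ContinuousOn N (Set.Icc 0 1)) (hg : ∀ t ∈ Set.Icc (0 : ℝ) 1, HasDerivAt g (N t (g t)) t)
    (h0 : g 0 = 0) : g 1 = 0 := by
  obtain ⟨K, hK⟩ := isCompact_Icc.exists_bound_of_continuousOn hN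
  refine eq_zero_of_abs_deriv_le_mul_abs_self_of_eq_zero_right (f' := fun t => N t (g t))
    (K := K) (fun t ht => (hg t ht).continuousAt.continuousWithinAt)
    (fun t ht => (hg t (Set.Ico_subset_Icc_self ht)).hasDerivWithinAt) h0 (fun t ht => ?_) 1
    (by norm_num)
  exact (N t).le_of_opNorm_le (hK t (Set.Ico_subset_Icc_self ht)) _

/-- A flat section is determined by its value at one point. -/
theorem flat_section_unique [CompleteSpace V] {Ω : E → E →L[ℂ] V →L[ℂ] V} {p : E}
    (hΩ : AnalyticAt ℂ Ω p)
    {U : E → V} (hU : AnalyticAt ℂ U p) (hflat : ∀ᶠ q in 𝓝 p, ∀ w, fderiv ℂ U q w = Ω q w (U q))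
    (h0 : U p = 0) : ∀ᶠ q in 𝓝 p, U q = 0 := by
  obtain ⟨r, hr, hball⟩ := Metric.eventually_nhds_iff_ball.1
    (hΩ.eventually_continuousAt.and (hU.eventually_analyticAt.and hflat))
  filter_upwards [Metric.ball_mem_nhds p hr] with q hq
  set v := q - p with hv
  have hvr : ‖v‖ < r := by rwa [hv, ← mem_ball_iff_norm]
  have key := eq_zero_of_linear_ode (g := fun t : ℝ => U (p + (t : ℂ) • v))
    (N := fun t => Ω (p + (t : ℂ) • v) v) ?_ ?_ ?_
  · simpa [hv] using key
  · intro t ht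
    have h1 : ContinuousAt (fun t : ℝ => Ω (p + (t : ℂ) • v)) t :=
      ContinuousAt.comp (f := fun t : ℝ => p + (t : ℂ) • v) (hball _ (ray_mem_ball hvr ht)).1
        (hasDerivAt_ray p v t).continuousAt
    exact (h1.clm_apply continuousAt_const).continuousWithinAt
  · intro t ht
    have h1 := hball _ (ray_mem_ball (p := p) hvr ht)
    have h2 := hasDerivAt_comp_ray h1.2.1.differentiableAt.hasFDerivAt
    rwa [h1.2.2] at h2
  · simpa using h0

/-- Derivative of the radial equation in an arbitrary direction. -/
theorem radial_deriv [CompleteSpace V] {Ω : E → E →L[ℂ] V →L[ℂ] V} {p q : E} {U : E → V}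
    (hΩ : AnalyticAt ℂ Ω q) (hU : AnalyticAt ℂ U q)
    (hrad : ∀ᶠ q in 𝓝 q, fderiv ℂ U q (q - p) = Ω q (q - p) (U q)) (w : E) :
    fderiv ℂ (fderiv ℂ U) q w (q - p) + fderiv ℂ U q w =
      fderiv ℂ Ω q w (q - p) (U q) + Ω q w (U q) + Ω q (q - p) (fderiv ℂ U q w) := by
  have hsub : HasFDerivAt (fun q : E => q - p) (ContinuousLinearMap.id ℂ E) q :=
    (hasFDerivAt_id q).sub_const p
  have hD := hU.fderiv.differentiableAt.hasFDerivAt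
  have hU' := hU.differentiableAt.hasFDerivAt
  have hΩ' := hΩ.differentiableAt.hasFDerivAt
  have h1 := hD.clm_apply hsub
  have h2 := (hΩ'.clm_apply hsub).clm_apply hU'
  have h3 := congrArg (fun A => A w) ((h1.congr_of_eventuallyEq
    (hrad.mono fun _ h => h.symm)).unique h2)
  simp only [add_apply, ContinuousLinearMap.comp_apply, ContinuousLinearMap.flip_apply,
    ContinuousLinearMap.id_apply] at h3
  rw [add_comm, h3]
  abel

/-- The covariant derivative of a solution of the radial equation satisfies a homogeneous linear
differential equation along rays, as soon as the curvature annihilates the solution. -/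
theorem covariant_deriv_ray [CompleteSpace V] {Ω : E → E →L[ℂ] V →L[ℂ] V} {p v : E} {t : ℝ}
    {U : E → V} (hΩ : AnalyticAt ℂ Ω (p + (t : ℂ) • v)) (hU : AnalyticAt ℂ U (p + (t : ℂ) • v))
    (hrad : ∀ᶠ q in 𝓝 (p + (t : ℂ) • v), fderiv ℂ U q (q - p) = Ω q (q - p) (U q))
    (hcurv : ∀ v' w, fderiv ℂ Ω (p + (t : ℂ) • v) v' w (U (p + (t : ℂ) • v)) +
        Ω (p + (t : ℂ) • v) w (Ω (p + (t : ℂ) • v) v' (U (p + (t : ℂ) • v))) =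
      fderiv ℂ Ω (p + (t : ℂ) • v) w v' (U (p + (t : ℂ) • v)) +
        Ω (p + (t : ℂ) • v) v' (Ω (p + (t : ℂ) • v) w (U (p + (t : ℂ) • v)))) (w : E) :
    HasDerivAt (fun τ : ℝ => (τ : ℂ) • (fderiv ℂ U (p + (τ : ℂ) • v) w -
        Ω (p + (τ : ℂ) • v) w (U (p + (τ : ℂ) • v))))
      (Ω (p + (t : ℂ) • v) v ((t : ℂ) • (fderiv ℂ U (p + (t : ℂ) • v) w -
        Ω (p + (t : ℂ) • v) w (U (p + (t : ℂ) • v))))) t := by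
  have hr := radial_deriv hΩ hU hrad w
  have hr0 := hrad.self_of_nhds
  set q := p + (t : ℂ) • v with hq
  have hqp : q - p = (t : ℂ) • v := by simp [hq]
  have hD := hU.fderiv.differentiableAt.hasFDerivAt
  have hU' := hU.differentiableAt.hasFDerivAt
  have hΩ' := hΩ.differentiableAt.hasFDerivAt
  have hc := hasFDerivAt_const (𝕜 := ℂ) w q
  have hR := (hD.clm_apply hc).sub ((hΩ'.clm_apply hc).clm_apply hU')
  have hRt := hasDerivAt_comp_ray hR
  have ht : HasDerivAt (fun τ : ℝ => (τ : ℂ)) 1 t := Complex.ofRealCLM.hasDerivAt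
  have key := ht.smul hRt
  refine key.congr_deriv ?_
  have hsymm : fderiv ℂ (fderiv ℂ U) q v w = fderiv ℂ (fderiv ℂ U) q w v :=
    second_derivative_symmetric_of_eventually (𝕜 := ℂ) (f := U) (f' := fderiv ℂ U)
      (hU.eventually_analyticAt.mono fun z hz => hz.differentiableAt.hasFDerivAt) hD v w
  have hcv := hcurv v w
  rw [hqp] at hr hr0
  simp only [map_smul, smul_apply] at hr hr0
  simp only [sub_apply, add_apply, ContinuousLinearMap.comp_apply, ContinuousLinearMap.flip_apply,
    zero_apply, map_zero, zero_add, one_smul, smul_sub, smul_add,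
    map_smul, map_sub, hsymm]
  have hr1 := congrArg (Ω q w) hr0
  rw [map_smul, map_smul] at hr1
  change _ + (fderiv ℂ U q w - Ω q w (U q)) = _
  -- The radial equation differentiated in direction `w`, minus `t` times the curvature identity,
  -- minus `Ω q w` applied to the radial equation.
  linear_combination (norm := module) hr - (t : ℂ) • hcv - hr1

/-- Frobenius theorem: if the subbundle `ker C` is preserved by the connection `Ω` and the curvature
of `Ω` vanishes on it, there is a flat section through every point of `ker C`. -/
theorem exists_flat_section [CompleteSpace V] [CompleteSpace W]
    {Ω : E → E →L[ℂ] V →L[ℂ] V} {C : E → V →L[ℂ] W}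
    {p : E} (hΩ : AnalyticAt ℂ Ω p) (hC : AnalyticAt ℂ C p)
    (hpar : ∀ᶠ q in 𝓝 p, ∀ w U, fderiv ℂ C q w U + C q (Ω q w U) = 0)
    (hcurv : ∀ᶠ q in 𝓝 p, ∀ U, C q U = 0 → ∀ v w,
      fderiv ℂ Ω q v w U + Ω q w (Ω q v U) = fderiv ℂ Ω q w v U + Ω q v (Ω q w U))
    {U₀ : V} (hU₀ : C p U₀ = 0) :
    ∃ U : E → V, AnalyticAt ℂ U p ∧ U p = U₀ ∧ (∀ᶠ q in 𝓝 p, C q (U q) = 0) ∧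
      ∀ᶠ q in 𝓝 p, ∀ w, fderiv ℂ U q w = Ω q w (U q) := by
  obtain ⟨U, hU, hUp, hrad⟩ := exists_radial_solution hΩ U₀
  refine ⟨U, hU, hUp, ?_⟩
  obtain ⟨r, hr, hball⟩ := Metric.eventually_nhds_iff_ball.1 (hΩ.eventually_analyticAt.and
    (hU.eventually_analyticAt.and (hrad.eventually_nhds.and (hpar.and (hcurv.and
      hC.eventually_analyticAt)))))
  -- At `q = p` the radial equation reads `0 = 0`; its derivative there still gives the full
  -- flatness equation. This covers the parameter `t = 0` below, where one cannot divide by `t`.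
  have hbase : ∀ v, fderiv ℂ U p v = Ω p v (U p) := by
    intro v
    simpa using radial_deriv hΩ hU hrad v
  have hconstr : ∀ q ∈ Metric.ball p r, C q (U q) = 0 := by
    intro q hq
    set v := q - p with hv
    have hvr : ‖v‖ < r := by rwa [hv, ← mem_ball_iff_norm]
    -- Along a ray the derivative of `C U` is `(dC + C Ω) U`, which vanishes by `hpar`: the
    -- constraint is constant along rays.
    have key := eq_zero_of_linear_ode (g := fun t : ℝ => C (p + (t : ℂ) • v) (U (p + (t : ℂ) • v)))
      (N := fun _ => 0) continuousOn_const ?_ (by simpa [hUp] using hU₀)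
    · simpa [hv] using key
    intro t ht
    obtain ⟨-, h2, h3, h4, -, h6⟩ := hball _ (ray_mem_ball (p := p) hvr ht)
    have hd := hasDerivAt_comp_ray
      (h6.differentiableAt.hasFDerivAt.clm_apply h2.differentiableAt.hasFDerivAt)
    refine hd.congr_deriv ?_
    have hUv : fderiv ℂ U (p + (t : ℂ) • v) v = Ω (p + (t : ℂ) • v) v (U (p + (t : ℂ) • v)) := by
      by_cases h0 : (t : ℂ) = 0
      · simpa [h0] using hbase v
      · have := h3.self_of_nhds
        rw [add_sub_cancel_left, map_smul, map_smul, smul_apply] at this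
        exact smul_right_injective V h0 this
    have := h4 v (U (p + (t : ℂ) • v))
    simp only [add_apply, ContinuousLinearMap.comp_apply, ContinuousLinearMap.flip_apply,
      zero_apply, hUv]
    rw [add_comm, this]
  refine ⟨eventually_of_mem (Metric.ball_mem_nhds p hr) hconstr, ?_⟩
  filter_upwards [Metric.ball_mem_nhds p hr] with q hq w
  set v := q - p with hv
  have hvr : ‖v‖ < r := by rwa [hv, ← mem_ball_iff_norm]
  -- The covariant derivative is weighted by `τ`, so its initial value vanishes automatically. The
  -- weighted quantity solves a homogeneous linear ODE, and its value at `τ = 1` is the covariant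
  -- derivative at `q`.
  have hcov := eq_zero_of_linear_ode
    (g := fun τ : ℝ => (τ : ℂ) • (fderiv ℂ U (p + (τ : ℂ) • v) w -
      Ω (p + (τ : ℂ) • v) w (U (p + (τ : ℂ) • v))))
    (N := fun t => Ω (p + (t : ℂ) • v) v) ?_ ?_ (by simp)
  · have := sub_eq_zero.1 (by simpa [hv] using hcov)
    exact this
  · intro t ht
    have h1 : ContinuousAt (fun t : ℝ => Ω (p + (t : ℂ) • v)) t :=
      ContinuousAt.comp (f := fun t : ℝ => p + (t : ℂ) • v)
        (hball _ (ray_mem_ball hvr ht)).1.continuousAt (hasDerivAt_ray p v t).continuousAt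
    exact (h1.clm_apply continuousAt_const).continuousWithinAt
  · intro t ht
    have hb := ray_mem_ball (p := p) hvr ht
    obtain ⟨h1, h2, h3, h4, h5, h6⟩ := hball _ hb
    exact covariant_deriv_ray h1 h2 h3 (h5 _ (hconstr _ hb)) w

end Frobenius

end PeriodDE

namespace PeriodDE

/-! ### Compatibility of a pair of second order equations -/

/-- The partial derivatives of order three of a germ. -/
noncomputable def jet3G (p : ℂ × ℂ) (g : HolGerm p) : Fin 4 → HolGerm p :=
  ![dl p (dl p (dl p g)), dl p (dl p (dm p g)), dl p (dm p (dm p g)), dm p (dm p (dm p g))]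

/-- Coefficients of the terms of order at most two in the derivative along the first coordinate of
an operator with coefficients `a`, whose derivatives are `da`. -/
def lowL {R : Type*} [Add R] (a da : Fin 6 → R) : Fin 6 → R :=
  ![da 0, da 1 + a 0, da 2, da 3 + a 1, da 4 + a 2, da 5]

/-- Coefficients of the terms of order at most two in the derivative along the second coordinate of
an operator with coefficients `a`, whose derivatives are `da`. -/
def lowM {R : Type*} [Add R] (a da : Fin 6 → R) : Fin 6 → R :=
  ![da 0, da 1, da 2 + a 0, da 3, da 4 + a 1, da 5 + a 2]

/-- The rows `t` express the third order derivatives of solutions of the equation with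
coefficients `a` through the lower ones. -/
structure Prolongs {R : Type*} [CommRing R] (a da db : Fin 6 → R) (t : Fin 4 → Fin 6 → R) :
    Prop where
  left : ∀ k, a 3 * t 0 k + a 4 * t 1 k + a 5 * t 2 k + lowL a da k = 0
  right : ∀ k, a 3 * t 1 k + a 4 * t 2 k + a 5 * t 3 k + lowM a db k = 0

/-- The defect of the third order derivatives of `g` from the values prescribed by `t`. -/
noncomputable def defect {p : ℂ × ℂ} (t : Fin 4 → Fin 6 → HolGerm p) (g : HolGerm p) (i : Fin 4) :
    HolGerm p :=
  jet3G p g i - ∑ k, t i k * jetG p g k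

/-- The rows `t` cancel every term of order at most two in the differentiated operator, so only the
failure of the third derivatives to be the prescribed ones remains. -/
theorem dl_opG {p : ℂ × ℂ} {a : Fin 6 → HolGerm p} {t : Fin 4 → Fin 6 → HolGerm p}
    (h : Prolongs a (fun k => dl p (a k)) (fun k => dm p (a k)) t) (g : HolGerm p) :
    dl p (opG p a g) = a 3 * defect t g 0 + a 4 * defect t g 1 + a 5 * defect t g 2 := by
  have h0 := h.left 0
  have h1 := h.left 1
  have h2 := h.left 2
  have h3 := h.left 3
  have h4 := h.left 4
  have h5 := h.left 5
  simp [lowL] at h0 h1 h2 h3 h4 h5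
  simp [opG, jetG, defect, jet3G, Fin.sum_univ_succ, dl_mul]
  linear_combination g * h0 + dl p g * h1 + dm p g * h2 + dl p (dl p g) * h3 +
    dl p (dm p g) * h4 + dm p (dm p g) * h5

theorem dm_opG {p : ℂ × ℂ} {a : Fin 6 → HolGerm p} {t : Fin 4 → Fin 6 → HolGerm p}
    (h : Prolongs a (fun k => dl p (a k)) (fun k => dm p (a k)) t) (g : HolGerm p) :
    dm p (opG p a g) = a 3 * defect t g 1 + a 4 * defect t g 2 + a 5 * defect t g 3 := by
  have h0 := h.right 0
  have h1 := h.right 1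
  have h2 := h.right 2
  have h3 := h.right 3
  have h4 := h.right 4
  have h5 := h.right 5
  simp [lowM] at h0 h1 h2 h3 h4 h5
  simp [opG, jetG, defect, jet3G, Fin.sum_univ_succ, dm_mul, dm_dl]
  linear_combination g * h0 + dl p g * h1 + dm p g * h2 + dl p (dl p g) * h3 +
    dl p (dm p g) * h4 + dm p (dm p g) * h5

/-- The system has the Sylvester matrix of the two quadratic forms, whose determinant is `symbolRes
a b`. The middle unknowns are eliminated first, then the outer ones. -/
theorem eq_zero_of_sylvester {R : Type*} [CommRing R] {a b : Fin 6 → R}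
    (hab : IsUnit (symbolRes a b)) {r : Fin 4 → R}
    (h1 : a 3 * r 0 + a 4 * r 1 + a 5 * r 2 = 0) (h2 : a 3 * r 1 + a 4 * r 2 + a 5 * r 3 = 0)
    (h3 : b 3 * r 0 + b 4 * r 1 + b 5 * r 2 = 0) (h4 : b 3 * r 1 + b 4 * r 2 + b 5 * r 3 = 0) :
    r = 0 := by
  have e1 : symbolRes a b * r 1 = 0 := by
    rw [symbolRes]
    linear_combination ((a 4 * b 5 - a 5 * b 4) * b 3) * h1 - ((a 4 * b 5 - a 5 * b 4) * a 3) * h3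
      + (a 3 * b 5 - a 5 * b 3) * b 5 * h2 - (a 3 * b 5 - a 5 * b 3) * a 5 * h4
  have e2 : symbolRes a b * r 2 = 0 := by
    rw [symbolRes]
    linear_combination -(a 3 * b 5 - a 5 * b 3) * b 3 * h1 + (a 3 * b 5 - a 5 * b 3) * a 3 * h3
      - (a 3 * b 4 - a 4 * b 3) * b 5 * h2 + (a 3 * b 4 - a 4 * b 3) * a 5 * h4
  have z1 : r 1 = 0 := hab.mul_right_eq_zero.1 e1
  have z2 : r 2 = 0 := hab.mul_right_eq_zero.1 e2
  rw [z1, z2] at h1 h2 h3 h4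
  have z0 : r 0 = 0 := hab.mul_right_eq_zero.1 (by
    rw [symbolRes]
    linear_combination ((a 3 * b 5 - a 5 * b 3) * b 5 - (a 4 * b 5 - a 5 * b 4) * b 4) * h1
      + (-(a 3 * b 5 - a 5 * b 3) * a 5 + (a 4 * b 5 - a 5 * b 4) * a 4) * h3)
  have z3 : r 3 = 0 := hab.mul_right_eq_zero.1 (by
    rw [symbolRes]
    linear_combination (-(a 3 * b 5 - a 5 * b 3) * b 3 + (a 3 * b 4 - a 4 * b 3) * b 4) * h2
      + ((a 3 * b 5 - a 5 * b 3) * a 3 - (a 3 * b 4 - a 4 * b 3) * a 4) * h4)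
  ext i
  fin_cases i <;> assumption

/-- Eliminating `r 0` from the first two equations leaves, together with the third, a 2×2 system in
`r 1`, `r 2` whose determinant is again the resultant. -/
theorem eq_zero_of_koszul {R : Type*} [CommRing R] {a b : Fin 6 → R}
    (hab : IsUnit (symbolRes a b)) {r : Fin 3 → R}
    (h1 : a 3 * r 0 + a 4 * r 1 + a 5 * r 2 = 0) (h2 : b 3 * r 0 + b 4 * r 1 + b 5 * r 2 = 0)
    (h3 : (a 3 * b 5 - a 5 * b 3) * r 1 + (a 4 * b 5 - a 5 * b 4) * r 2 = 0) : r = 0 := by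
  have e : (a 3 * b 4 - a 4 * b 3) * r 1 + (a 3 * b 5 - a 5 * b 3) * r 2 = 0 := by
    linear_combination a 3 * h2 - b 3 * h1
  have z1 : r 1 = 0 := hab.mul_right_eq_zero.1 (by
    rw [symbolRes]
    linear_combination (a 3 * b 5 - a 5 * b 3) * h3 - (a 4 * b 5 - a 5 * b 4) * e)
  have z2 : r 2 = 0 := hab.mul_right_eq_zero.1 (by
    rw [symbolRes]
    linear_combination (a 3 * b 5 - a 5 * b 3) * e - (a 3 * b 4 - a 4 * b 3) * h3)
  rw [z1, z2] at h1 h2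
  have z0 : r 0 = 0 := hab.mul_right_eq_zero.1 (by
    rw [symbolRes]
    linear_combination ((a 3 * b 5 - a 5 * b 3) * b 5 - (a 4 * b 5 - a 5 * b 4) * b 4) * h1
      + (-(a 3 * b 5 - a 5 * b 3) * a 5 + (a 4 * b 5 - a 5 * b 4) * a 4) * h2)
  ext i
  fin_cases i <;> assumption

/-- If the third order derivatives of `g` at `p` are the prescribed ones, then the prescribed values
are closed to first order at `p`. -/
theorem ev_dm_defect {p : ℂ × ℂ} {a b : Fin 6 → HolGerm p} {t : Fin 4 → Fin 6 → HolGerm p}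
    (ha : Prolongs a (fun k => dl p (a k)) (fun k => dm p (a k)) t)
    (hb : Prolongs b (fun k => dl p (b k)) (fun k => dm p (b k)) t)
    (hab : HolGerm.ev p (symbolRes a b) ≠ 0) {g : HolGerm p}
    (hsyz : FlatAt p (opG p a g) → FlatAt p (opG p b g) →
      HolGerm.ev p (opG p b (opG p a g)) = HolGerm.ev p (opG p a (opG p b g)))
    (hga : HolGerm.ev p (opG p a g) = 0) (hgb : HolGerm.ev p (opG p b g) = 0)
    (hd : ∀ i, HolGerm.ev p (defect t g i) = 0) (i : Fin 3) :
    HolGerm.ev p (dm p (defect t g i.castSucc)) = HolGerm.ev p (dl p (defect t g i.succ)) := by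
  have la := dl_opG ha g
  have ma := dm_opG ha g
  have lb := dl_opG hb g
  have mb := dm_opG hb g
  have hs := hsyz ⟨hga, by rw [la]; simp [hd], by rw [ma]; simp [hd]⟩
    ⟨hgb, by rw [lb]; simp [hd], by rw [mb]; simp [hd]⟩
  -- Three unknowns, the differences of the two sides for `i = 0, 1, 2`, and three equations:
  -- symmetry of the mixed derivative of each operator applied to `g`, and the syzygy `hs`.
  have ka := dm_dl p (opG p a g)
  have kb := dm_dl p (opG p b g)
  rw [la, ma] at ka
  rw [lb, mb] at kb
  apply_fun HolGerm.ev p at ka kb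
  -- On a germ vanishing to first order, only the principal part of an operator contributes to the
  -- value at `p`.
  have hs' : ∀ x y : Fin 6 → HolGerm p, ∀ h : HolGerm p, HolGerm.ev p h = 0 →
      HolGerm.ev p (dl p h) = 0 → HolGerm.ev p (dm p h) = 0 →
      HolGerm.ev p (opG p x h) = HolGerm.ev p (x 3) * HolGerm.ev p (dl p (dl p h)) +
        HolGerm.ev p (x 4) * HolGerm.ev p (dl p (dm p h)) +
        HolGerm.ev p (x 5) * HolGerm.ev p (dm p (dm p h)) := by
    intro x y h e1 e2 e3
    simp [opG, jetG, Fin.sum_univ_succ, e1, e2, e3]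
    ring
  rw [hs' b a _ hga (by rw [la]; simp [hd]) (by rw [ma]; simp [hd]),
    hs' a b _ hgb (by rw [lb]; simp [hd]) (by rw [mb]; simp [hd]), la, ma, lb, mb] at hs
  simp only [map_add, dl_mul, dm_mul, map_mul, hd, mul_zero, zero_add] at hs ka kb
  have := eq_zero_of_koszul (a := fun k => HolGerm.ev p (a k)) (b := fun k => HolGerm.ev p (b k))
    (r := fun i : Fin 3 => HolGerm.ev p (dm p (defect t g i.castSucc)) -
      HolGerm.ev p (dl p (defect t g i.succ)))
    (by simpa [symbolRes, isUnit_iff_ne_zero] using hab)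
    (by
      simp
      linear_combination ka)
    (by
      simp
      linear_combination kb)
    (by
      simp
      linear_combination hs)
  exact sub_eq_zero.1 (congrFun this i)

/-- Every jet of order three is the jet of a germ. -/
theorem exists_jet (p : ℂ × ℂ) (U : Fin 6 → ℂ) (c : Fin 4 → ℂ) : ∃ g : HolGerm p,
    (∀ k, HolGerm.ev p (jetG p g k) = U k) ∧ ∀ i, HolGerm.ev p (jet3G p g i) = c i := by
  have hx : ∃ x : HolGerm p, HolGerm.ev p x = 0 ∧ dl p x = 1 ∧ dm p x = 0 :=
    ⟨lamG p - HolGerm.const p p.1, sub_self _,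
      by rw [map_sub, dl_lamG, dl_const, sub_zero], by rw [map_sub, dm_lamG, dm_const, sub_zero]⟩
  have hy : ∃ y : HolGerm p, HolGerm.ev p y = 0 ∧ dl p y = 0 ∧ dm p y = 1 :=
    ⟨muG p - HolGerm.const p p.2, sub_self _,
      by rw [map_sub, dl_muG, dl_const, sub_zero], by rw [map_sub, dm_muG, dm_const, sub_zero]⟩
  obtain ⟨x, x0, x1, x2⟩ := hx
  obtain ⟨y, y0, y1, y2⟩ := hy
  have ec : ∀ z, HolGerm.ev p (HolGerm.const p z) = z := fun z => rfl
  have e2 : HolGerm.ev p 2 = 2 := map_ofNat (HolGerm.ev p) 2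
  have e3 : HolGerm.ev p 3 = 3 := map_ofNat (HolGerm.ev p) 3
  let C := HolGerm.const p
  -- The cubic Taylor polynomial in the centred coordinates; the denominators are the factorials of
  -- the exponents.
  refine ⟨C (U 0) + C (U 1) * x + C (U 2) * y + C (U 3 / 2) * x ^ 2 + C (U 4) * (x * y) +
    C (U 5 / 2) * y ^ 2 + C (c 0 / 6) * x ^ 3 + C (c 1 / 2) * (x ^ 2 * y) +
    C (c 2 / 2) * (x * y ^ 2) + C (c 3 / 6) * y ^ 3, ?_, ?_⟩
  · intro k
    fin_cases k <;>
    simp [C, jetG, dl_mul, dm_mul, dl_pow, dm_pow, dl_const, dm_const, x0, x1, x2, y0, y1, y2,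
      ec, e2, dl_ofNat, dm_ofNat]
  · intro i
    fin_cases i <;>
    simp [C, jet3G, dl_mul, dm_mul, dl_pow, dm_pow, dl_const, dm_const, x1, x2, y1, y2,
      ec, e2, e3, dl_ofNat, dm_ofNat] <;> ring

theorem HolGerm.isUnit_of_ev_ne_zero {p : ℂ × ℂ} {g : HolGerm p} (hg : HolGerm.ev p g ≠ 0) :
    IsUnit g := by
  obtain ⟨u, hu, rfl⟩ := HolGerm.exists_of g
  have h0 : u p ≠ 0 := hg
  refine IsUnit.of_mul_eq_one (HolGerm.of (fun q => (u q)⁻¹) (hu.inv h0)) ?_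
  rw [HolGerm.of_mul]
  change _ = HolGerm.of (fun _ => 1) analyticAt_const
  refine HolGerm.of_eq_of.2 ?_
  filter_upwards [hu.continuousAt.eventually_ne h0] with q hq
  exact mul_inv_cancel₀ hq

/-- Solutions have the prescribed third order derivatives. -/
theorem defect_eq_zero {p : ℂ × ℂ} {a b : Fin 6 → HolGerm p} {t : Fin 4 → Fin 6 → HolGerm p}
    (ha : Prolongs a (fun k => dl p (a k)) (fun k => dm p (a k)) t)
    (hb : Prolongs b (fun k => dl p (b k)) (fun k => dm p (b k)) t)
    (hab : HolGerm.ev p (symbolRes a b) ≠ 0) {g : HolGerm p}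
    (hga : opG p a g = 0) (hgb : opG p b g = 0) : defect t g = 0 := by
  apply eq_zero_of_sylvester (HolGerm.isUnit_of_ev_ne_zero hab)
  · rw [← dl_opG ha, hga, map_zero]
  · rw [← dm_opG ha, hga, map_zero]
  · rw [← dl_opG hb, hgb, map_zero]
  · rw [← dm_opG hb, hgb, map_zero]

end PeriodDE

namespace PeriodDE

/-! ### The connection on jets of order two -/

/-- The partial derivatives of order at most two of a function. -/
noncomputable def jet (u : ℂ × ℂ → ℂ) : Fin 6 → ℂ × ℂ → ℂ :=
  ![u, pd (1, 0) u, pd (0, 1) u, pd (1, 0) (pd (1, 0) u), pd (1, 0) (pd (0, 1) u),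
    pd (0, 1) (pd (0, 1) u)]

theorem analyticAt_jet {p : ℂ × ℂ} {u : ℂ × ℂ → ℂ} (hu : AnalyticAt ℂ u p) (k : Fin 6) :
    AnalyticAt ℂ (jet u k) p := by
  fin_cases k
  · exact hu
  · exact analyticAt_pd hu
  · exact analyticAt_pd hu
  · exact analyticAt_pd (analyticAt_pd hu)
  · exact analyticAt_pd (analyticAt_pd hu)
  · exact analyticAt_pd (analyticAt_pd hu)

theorem jetG_of {p : ℂ × ℂ} {u : ℂ × ℂ → ℂ} (hu : AnalyticAt ℂ u p) (k : Fin 6) :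
    jetG p (HolGerm.of u hu) k = HolGerm.of (jet u k) (analyticAt_jet hu k) := by
  fin_cases k <;> rfl

theorem HolGerm.of_sum {p : ℂ × ℂ} {ι : Type*} (s : Finset ι) {u : ι → ℂ × ℂ → ℂ}
    (hu : ∀ i, AnalyticAt ℂ (u i) p) :
    ∑ i ∈ s, HolGerm.of (u i) (hu i) = HolGerm.of (fun q => ∑ i ∈ s, u i q)
      (Finset.analyticAt_fun_sum s fun i _ => hu i) := by
  classical
  induction s using Finset.induction_on with
  | empty => rfl
  | insert i s hi ih =>
    rw [Finset.sum_insert hi, ih, HolGerm.of_add, HolGerm.of_eq_of]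
    exact Eventually.of_forall fun q => (Finset.sum_insert (f := fun i => u i q) hi).symm

theorem opG_of {p : ℂ × ℂ} {a : Fin 6 → ℂ × ℂ → ℂ} (ha : ∀ k, AnalyticAt ℂ (a k) p)
    {u : ℂ × ℂ → ℂ} (hu : AnalyticAt ℂ u p) :
    opG p (fun k => HolGerm.of (a k) (ha k)) (HolGerm.of u hu) =
      HolGerm.of (fun q => ∑ k, a k q * jet u k q)
        (Finset.analyticAt_fun_sum _ fun k _ => (ha k).mul (analyticAt_jet hu k)) := by
  simp only [opG, jetG_of, HolGerm.of_mul]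
  exact HolGerm.of_sum _ _

/-- The derivative along the first coordinate of a jet `U` of a solution. -/
def shiftL {R : Type*} [CommRing R] (t : Fin 4 → Fin 6 → R) (U : Fin 6 → R) : Fin 6 → R :=
  ![U 1, U 3, U 4, ∑ k, t 0 k * U k, ∑ k, t 1 k * U k, ∑ k, t 2 k * U k]

/-- The derivative along the second coordinate of a jet `U` of a solution. -/
def shiftM {R : Type*} [CommRing R] (t : Fin 4 → Fin 6 → R) (U : Fin 6 → R) : Fin 6 → R :=
  ![U 2, U 4, U 5, ∑ k, t 1 k * U k, ∑ k, t 2 k * U k, ∑ k, t 3 k * U k]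

theorem dl_jetG {p : ℂ × ℂ} (t : Fin 4 → Fin 6 → HolGerm p) (g : HolGerm p) (k : Fin 6) :
    dl p (jetG p g k) = shiftL t (jetG p g) k +
      (![0, 0, 0, defect t g 0, defect t g 1, defect t g 2] : Fin 6 → HolGerm p) k := by
  fin_cases k <;> simp [jetG, shiftL, defect, jet3G]

theorem dm_jetG {p : ℂ × ℂ} (t : Fin 4 → Fin 6 → HolGerm p) (g : HolGerm p) (k : Fin 6) :
    dm p (jetG p g k) = shiftM t (jetG p g) k +
      (![0, 0, 0, defect t g 1, defect t g 2, defect t g 3] : Fin 6 → HolGerm p) k := by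
  fin_cases k <;> simp [jetG, shiftM, defect, jet3G, dm_dl]

theorem map_shiftL {R S : Type*} [CommRing R] [CommRing S] (f : R →+* S) (t : Fin 4 → Fin 6 → R)
    (U : Fin 6 → R) (k : Fin 6) :
    f (shiftL t U k) = shiftL (fun i k => f (t i k)) (fun k => f (U k)) k := by
  fin_cases k <;> simp [shiftL]

theorem map_shiftM {R S : Type*} [CommRing R] [CommRing S] (f : R →+* S) (t : Fin 4 → Fin 6 → R)
    (U : Fin 6 → R) (k : Fin 6) :
    f (shiftM t U k) = shiftM (fun i k => f (t i k)) (fun k => f (U k)) k := by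
  fin_cases k <;> simp [shiftM]

/-- The matrix of the connection in the first coordinate direction. -/
def matL {R : Type*} [CommRing R] (t : Fin 4 → Fin 6 → R) : Fin 6 → Fin 6 → R :=
  ![Pi.single 1 1, Pi.single 3 1, Pi.single 4 1, t 0, t 1, t 2]

/-- The matrix of the connection in the second coordinate direction. -/
def matM {R : Type*} [CommRing R] (t : Fin 4 → Fin 6 → R) : Fin 6 → Fin 6 → R :=
  ![Pi.single 2 1, Pi.single 4 1, Pi.single 5 1, t 1, t 2, t 3]

theorem sum_matL {R : Type*} [CommRing R] (t : Fin 4 → Fin 6 → R) (U : Fin 6 → R) (k : Fin 6) :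
    ∑ l, matL t k l * U l = shiftL t U k := by
  fin_cases k <;> simp [matL, shiftL, Pi.single_apply]

theorem sum_matM {R : Type*} [CommRing R] (t : Fin 4 → Fin 6 → R) (U : Fin 6 → R) (k : Fin 6) :
    ∑ l, matM t k l * U l = shiftM t U k := by
  fin_cases k <;> simp [matM, shiftM, Pi.single_apply]

/-- The elementary endomorphism with entry in row `k` and column `l`. -/
noncomputable def elem (k l : Fin 6) : (Fin 6 → ℂ) →L[ℂ] (Fin 6 → ℂ) :=
  (ContinuousLinearMap.proj (R := ℂ) (φ := fun _ : Fin 6 => ℂ) l).smulRight (Pi.single k 1)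

/-- The connection form on jets. -/
noncomputable def conn (t : Fin 4 → Fin 6 → ℂ × ℂ → ℂ) (q : ℂ × ℂ) :
    ℂ × ℂ →L[ℂ] (Fin 6 → ℂ) →L[ℂ] (Fin 6 → ℂ) :=
  ∑ k, ∑ l, (matL (fun i k => t i k q) k l • (ContinuousLinearMap.fst ℂ ℂ ℂ).smulRight (elem k l) +
    matM (fun i k => t i k q) k l • (ContinuousLinearMap.snd ℂ ℂ ℂ).smulRight (elem k l))

theorem conn_apply (t : Fin 4 → Fin 6 → ℂ × ℂ → ℂ) (q w : ℂ × ℂ) (U : Fin 6 → ℂ) (k : Fin 6) :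
    conn t q w U k = w.1 * shiftL (fun i k => t i k q) U k +
      w.2 * shiftM (fun i k => t i k q) U k := by
  simp only [conn, ← sum_matL, ← sum_matM, sum_apply, add_apply, smul_apply, Finset.sum_apply,
    Pi.add_apply, Pi.smul_apply, ContinuousLinearMap.smulRight_apply, elem,
    ContinuousLinearMap.coe_fst', ContinuousLinearMap.coe_snd', ContinuousLinearMap.proj_apply,
    smul_eq_mul, Finset.mul_sum, ← Finset.sum_add_distrib]
  rw [Finset.sum_comm]
  refine Finset.sum_congr rfl fun l _ => ?_
  rw [Finset.sum_eq_single k]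
  · simp; ring
  · intro j _ hj
    simp [hj.symm]
  · simp

theorem analyticAt_smul_const {E F : Type*} [NormedAddCommGroup E] [NormedSpace ℂ E]
    [NormedAddCommGroup F] [NormedSpace ℂ F] {f : E → ℂ} {q : E} (h : AnalyticAt ℂ f q) (c : F) :
    AnalyticAt ℂ (fun z => f z • c) q :=
  h.smul analyticAt_const

theorem analyticAt_conn {t : Fin 4 → Fin 6 → ℂ × ℂ → ℂ} {q : ℂ × ℂ}
    (ht : ∀ i k, AnalyticAt ℂ (t i k) q) : AnalyticAt ℂ (conn t) q := by
  have hL : ∀ k l, AnalyticAt ℂ (fun q => matL (fun i k => t i k q) k l) q := by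
    intro k l
    fin_cases k
    · exact analyticAt_const
    · exact analyticAt_const
    · exact analyticAt_const
    · exact ht 0 l
    · exact ht 1 l
    · exact ht 2 l
  have hM : ∀ k l, AnalyticAt ℂ (fun q => matM (fun i k => t i k q) k l) q := by
    intro k l
    fin_cases k
    · exact analyticAt_const
    · exact analyticAt_const
    · exact analyticAt_const
    · exact ht 1 l
    · exact ht 2 l
    · exact ht 3 l
  exact Finset.analyticAt_fun_sum _ fun k _ => Finset.analyticAt_fun_sum _ fun l _ =>
    (analyticAt_smul_const (hL k l) _).add (analyticAt_smul_const (hM k l) _)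

/-- Vanishing of the curvature on a vector which extends to a section `S`, flat at `q`, such that
the form `Ω S` is closed at `q`. -/
theorem curvature_eq {E V : Type*} [NormedAddCommGroup E] [NormedSpace ℂ E]
    [NormedAddCommGroup V] [NormedSpace ℂ V] {Ω : E → E →L[ℂ] V →L[ℂ] V} {q : E}
    (hΩ : DifferentiableAt ℂ Ω q) {S : E → V} (hS : DifferentiableAt ℂ S q)
    (hflat : ∀ w, fderiv ℂ S q w = Ω q w (S q))
    (hclosed : ∀ v w, fderiv ℂ (fun z => Ω z w (S z)) q v = fderiv ℂ (fun z => Ω z v (S z)) q w)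
    (v w : E) :
    fderiv ℂ Ω q v w (S q) + Ω q w (Ω q v (S q)) =
      fderiv ℂ Ω q w v (S q) + Ω q v (Ω q w (S q)) := by
  have key : ∀ v w, fderiv ℂ (fun z => Ω z w (S z)) q v =
      fderiv ℂ Ω q v w (S q) + Ω q w (Ω q v (S q)) := by
    intro v w
    have h := (hΩ.hasFDerivAt.clm_apply (hasFDerivAt_const w q)).clm_apply hS.hasFDerivAt
    rw [h.fderiv]
    simp only [add_apply, ContinuousLinearMap.comp_apply, ContinuousLinearMap.flip_apply,
      zero_apply, map_zero, zero_add, hflat]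
    rw [add_comm]
  rw [← key, ← key, hclosed]

end PeriodDE

/-! ### Analytic solution of the Sylvester system for the third derivatives. -/

namespace PeriodDE

/-- The Sylvester matrix of the principal symbols. -/
def sylvester {R : Type*} [CommRing R] (a b : Fin 6 → R) : Matrix (Fin 4) (Fin 4) R :=
  !![a 3, a 4, a 5, 0; 0, a 3, a 4, a 5; b 3, b 4, b 5, 0; 0, b 3, b 4, b 5]

theorem det_sylvester {R : Type*} [CommRing R] (a b : Fin 6 → R) :
    (sylvester a b).det = symbolRes a b := by
  simp [sylvester, symbolRes, Matrix.det_succ_row_zero, Fin.sum_univ_succ, Fin.succAbove]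
  ring

theorem analyticAt_det {E : Type*} [NormedAddCommGroup E] [NormedSpace ℂ E] {n : Type*} [Fintype n]
    [DecidableEq n] {S : E → Matrix n n ℂ} {q : E} (hS : ∀ i j, AnalyticAt ℂ (fun z => S z i j) q) :
    AnalyticAt ℂ (fun z => (S z).det) q := by
  simp only [Matrix.det_apply']
  exact Finset.analyticAt_fun_sum _ fun σ _ => analyticAt_const.mul
    (Finset.analyticAt_fun_prod _ fun i _ => hS _ _)

/-- Cramer's rule: the entries of the inverse are quotients of determinants with analytic entries.
-/
theorem analyticAt_inv {E : Type*} [NormedAddCommGroup E] [NormedSpace ℂ E] {n : Type*} [Fintype n]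
    [DecidableEq n] {S : E → Matrix n n ℂ} {q : E} (hS : ∀ i j, AnalyticAt ℂ (fun z => S z i j) q)
    (h0 : (S q).det ≠ 0) (i j : n) : AnalyticAt ℂ (fun z => (S z)⁻¹ i j) q := by
  simp only [Matrix.inv_def, Matrix.smul_apply, Matrix.adjugate_apply, Ring.inverse_eq_inv',
    smul_eq_mul]
  refine ((analyticAt_det hS).inv h0).mul (analyticAt_det fun k l => ?_)
  by_cases hk : k = j
  · subst hk
    simpa using analyticAt_const
  · simpa [Matrix.updateRow_ne hk] using hS k l

section System

variable {a b : Fin 6 → ℂ × ℂ → ℂ}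

theorem exists_prolongation (ha : ∀ k q, AnalyticAt ℂ (a k) q) (hb : ∀ k q, AnalyticAt ℂ (b k) q) :
    ∃ t : Fin 4 → Fin 6 → ℂ × ℂ → ℂ, ∀ q, symbolRes (fun k => a k q) (fun k => b k q) ≠ 0 →
      (∀ i k, AnalyticAt ℂ (t i k) q) ∧
      Prolongs (fun k => a k q) (fun k => pd (1, 0) (a k) q) (fun k => pd (0, 1) (a k) q)
        (fun i k => t i k q) ∧
      Prolongs (fun k => b k q) (fun k => pd (1, 0) (b k) q) (fun k => pd (0, 1) (b k) q)
        (fun i k => t i k q) := by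
  let S : ℂ × ℂ → Matrix (Fin 4) (Fin 4) ℂ := fun q => sylvester (fun k => a k q) (fun k => b k q)
  let L : Fin 6 → ℂ × ℂ → Fin 4 → ℂ := fun k q =>
    ![lowL (fun k => a k q) (fun k => pd (1, 0) (a k) q) k,
      lowM (fun k => a k q) (fun k => pd (0, 1) (a k) q) k,
      lowL (fun k => b k q) (fun k => pd (1, 0) (b k) q) k,
      lowM (fun k => b k q) (fun k => pd (0, 1) (b k) q) k]
  have hSan : ∀ q i j, AnalyticAt ℂ (fun z => S z i j) q := by
    intro q i j
    fin_cases i <;> fin_cases j <;>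
      first | exact analyticAt_const | exact ha _ q | exact hb _ q
  have hLan : ∀ q k j, AnalyticAt ℂ (fun z => L k z j) q := by
    have h1 : ∀ c : Fin 6 → ℂ × ℂ → ℂ, (∀ k q, AnalyticAt ℂ (c k) q) → ∀ q k,
        AnalyticAt ℂ (fun z => lowL (fun k => c k z) (fun k => pd (1, 0) (c k) z) k) q := by
      intro c hc q k
      fin_cases k <;>
        first | exact analyticAt_pd (hc _ q) | exact (analyticAt_pd (hc _ q)).add (hc _ q)
    have h2 : ∀ c : Fin 6 → ℂ × ℂ → ℂ, (∀ k q, AnalyticAt ℂ (c k) q) → ∀ q k,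
        AnalyticAt ℂ (fun z => lowM (fun k => c k z) (fun k => pd (0, 1) (c k) z) k) q := by
      intro c hc q k
      fin_cases k <;>
        first | exact analyticAt_pd (hc _ q) | exact (analyticAt_pd (hc _ q)).add (hc _ q)
    intro q k j
    fin_cases j
    · exact h1 a ha q k
    · exact h2 a ha q k
    · exact h1 b hb q k
    · exact h2 b hb q k
  -- For each `k` the four `Prolongs` equations read `S t + L = 0`, whence `t = -S⁻¹ L`. One global
  -- function is defined, but it is controlled only where the resultant is nonzero.
  refine ⟨fun i k q => -∑ j, (S q)⁻¹ i j * L k q j, fun q hq => ?_⟩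
  have hdet : (S q).det ≠ 0 := by rwa [det_sylvester]
  have hsolve : ∀ k i, ∑ j, S q i j * (-∑ l, (S q)⁻¹ j l * L k q l) + L k q i = 0 := by
    intro k i
    have h1 : (S q).mulVec ((S q)⁻¹.mulVec (L k q)) = L k q := by
      rw [Matrix.mulVec_mulVec, Matrix.mul_nonsing_inv _ (isUnit_iff_ne_zero.2 hdet),
        Matrix.one_mulVec]
    have h2 := congrFun h1 i
    simp only [Matrix.mulVec, dotProduct] at h2
    simp only [mul_neg, Finset.sum_neg_distrib]
    rw [h2, neg_add_cancel]
  refine ⟨fun i k => (Finset.analyticAt_fun_sum _ fun j _ =>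
    (analyticAt_inv (hSan q) hdet i j).mul (hLan q k j)).neg, ⟨fun k => ?_, fun k => ?_⟩,
    ⟨fun k => ?_, fun k => ?_⟩⟩
  · have := hsolve k 0
    rw [Fin.sum_univ_four] at this
    simpa [S, L, sylvester] using this
  · have := hsolve k 1
    rw [Fin.sum_univ_four] at this
    simpa [S, L, sylvester] using this
  · have := hsolve k 2
    rw [Fin.sum_univ_four] at this
    simpa [S, L, sylvester] using this
  · have := hsolve k 3
    rw [Fin.sum_univ_four] at this
    simpa [S, L, sylvester] using this

/-- Germs of a family of analytic functions. -/
noncomputable def germs {ι : Type*} {a : ι → ℂ × ℂ → ℂ} {q : ℂ × ℂ}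
    (ha : ∀ k, AnalyticAt ℂ (a k) q) (k : ι) : HolGerm q :=
  HolGerm.of (a k) (ha k)

theorem prolongs_germs {a : Fin 6 → ℂ × ℂ → ℂ} {t : Fin 4 → Fin 6 → ℂ × ℂ → ℂ} {q : ℂ × ℂ}
    (ha : ∀ k, AnalyticAt ℂ (a k) q) (ht : ∀ i k, AnalyticAt ℂ (t i k) q)
    (h : ∀ᶠ z in 𝓝 q, Prolongs (fun k => a k z) (fun k => pd (1, 0) (a k) z)
      (fun k => pd (0, 1) (a k) z) (fun i k => t i k z)) :
    Prolongs (germs ha) (fun k => dl q (germs ha k)) (fun k => dm q (germs ha k))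
      (fun i k => germs (ht i) k) := by
  have key : ∀ (g : HolGerm q) (u : ℂ × ℂ → ℂ), (∀ᶠ z in 𝓝 q, u z = 0) →
      (g : Germ (𝓝 q) ℂ) = (u : Germ (𝓝 q) ℂ) → g = 0 := fun g u h0 hg =>
    Subtype.ext (hg.trans (Germ.coe_eq.2 h0))
  constructor
  · intro k
    have hk := h.mono fun z hz => hz.left k
    fin_cases k <;> exact key _ _ hk rfl
  · intro k
    have hk := h.mono fun z hz => hz.right k
    fin_cases k <;> exact key _ _ hk rfl

end System

end PeriodDE

/-! ### The connection on jets preserves the constraints and is flat on them. -/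

namespace PeriodDE

section System

variable {a b : Fin 6 → ℂ × ℂ → ℂ}

theorem fderiv_eq_pd (u : ℂ × ℂ → ℂ) (q w : ℂ × ℂ) :
    fderiv ℂ u q w = w.1 * pd (1, 0) u q + w.2 * pd (0, 1) u q := by
  have : w = w.1 • (1, 0) + w.2 • (0, 1) := by simp
  conv_lhs => rw [this, map_add, map_smul, map_smul]
  rfl

/-- Only the values of the defects at the single point `q` are needed. Thus it applies both to
genuine solutions and to the cubic test germs used for the curvature. -/
theorem jet_flat {u : ℂ × ℂ → ℂ} {t : Fin 4 → Fin 6 → ℂ × ℂ → ℂ} {q : ℂ × ℂ}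
    (hu : AnalyticAt ℂ u q) (ht : ∀ i k, AnalyticAt ℂ (t i k) q)
    (hd : ∀ i, HolGerm.ev q (defect (fun i k => germs (ht i) k) (HolGerm.of u hu) i) = 0)
    (w : ℂ × ℂ) : fderiv ℂ (fun z k => jet u k z) q w = conn t q w (fun k => jet u k q) := by
  have hj := fun k => analyticAt_jet hu k
  ext k
  rw [fderiv_pi (fun k => (hj k).differentiableAt), ContinuousLinearMap.pi_apply, conn_apply]
  have hL := congrArg (HolGerm.ev q) (dl_jetG (fun i k => germs (ht i) k) (HolGerm.of u hu) k)
  have hM := congrArg (HolGerm.ev q) (dm_jetG (fun i k => germs (ht i) k) (HolGerm.of u hu) k)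
  rw [map_add, map_shiftL] at hL
  rw [map_add, map_shiftM] at hM
  have e1 : HolGerm.ev q ((![0, 0, 0, defect (fun i k => germs (ht i) k) (HolGerm.of u hu) 0,
      defect (fun i k => germs (ht i) k) (HolGerm.of u hu) 1,
      defect (fun i k => germs (ht i) k) (HolGerm.of u hu) 2] : Fin 6 → HolGerm q) k) = 0 := by
    fin_cases k <;> simp [hd]
  have e2 : HolGerm.ev q ((![0, 0, 0, defect (fun i k => germs (ht i) k) (HolGerm.of u hu) 1,
      defect (fun i k => germs (ht i) k) (HolGerm.of u hu) 2,
      defect (fun i k => germs (ht i) k) (HolGerm.of u hu) 3] : Fin 6 → HolGerm q) k) = 0 := by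
    fin_cases k <;> simp [hd]
  rw [e1, add_zero, jetG_of] at hL
  rw [e2, add_zero, jetG_of] at hM
  simp only [jetG_of] at hL hM
  rw [fderiv_eq_pd]
  exact congrArg₂ (fun x y => w.1 * x + w.2 * y) hL hM

/-- The pair of constraints on jets given by a pair of equations. -/
noncomputable def constr (a b : Fin 6 → ℂ × ℂ → ℂ) (q : ℂ × ℂ) : (Fin 6 → ℂ) →L[ℂ] ℂ × ℂ :=
  ∑ k, (a k q • (ContinuousLinearMap.proj (R := ℂ) (φ := fun _ : Fin 6 => ℂ) k).smulRight (1, 0) +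
    b k q • (ContinuousLinearMap.proj (R := ℂ) (φ := fun _ : Fin 6 => ℂ) k).smulRight (0, 1))

theorem constr_apply (q : ℂ × ℂ) (U : Fin 6 → ℂ) :
    constr a b q U = (∑ k, a k q * U k, ∑ k, b k q * U k) := by
  ext <;> simp [constr, Prod.fst_sum, Prod.snd_sum]

theorem analyticAt_constr {q : ℂ × ℂ} (ha : ∀ k, AnalyticAt ℂ (a k) q)
    (hb : ∀ k, AnalyticAt ℂ (b k) q) : AnalyticAt ℂ (constr a b) q :=
  Finset.analyticAt_fun_sum _ fun k _ =>
    (analyticAt_smul_const (ha k) _).add (analyticAt_smul_const (hb k) _)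

theorem fderiv_constr_apply {q : ℂ × ℂ} (ha : ∀ k, AnalyticAt ℂ (a k) q)
    (hb : ∀ k, AnalyticAt ℂ (b k) q) (w : ℂ × ℂ) (U : Fin 6 → ℂ) :
    fderiv ℂ (constr a b) q w U =
      (∑ k, fderiv ℂ (a k) q w * U k, ∑ k, fderiv ℂ (b k) q w * U k) := by
  have h1 := ((analyticAt_constr ha hb).differentiableAt.hasFDerivAt.clm_apply
    (hasFDerivAt_const U q)).fderiv
  have h2 : HasFDerivAt (fun z => (∑ k, a k z * U k, ∑ k, b k z * U k))
      ((∑ k, U k • fderiv ℂ (a k) q).prod (∑ k, U k • fderiv ℂ (b k) q)) q :=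
    (HasFDerivAt.fun_sum fun k _ => (ha k).differentiableAt.hasFDerivAt.mul_const (U k)).prodMk
      (HasFDerivAt.fun_sum fun k _ => (hb k).differentiableAt.hasFDerivAt.mul_const (U k))
  simp only [constr_apply] at h1
  rw [h2.fderiv] at h1
  have h3 := congrArg (fun A => A w) h1
  simp only [add_apply, ContinuousLinearMap.comp_apply, zero_apply, map_zero, zero_add,
    ContinuousLinearMap.flip_apply] at h3
  rw [← h3]
  simp [mul_comm]

/-- For every vector `U`, constrained or not, this is the `Prolongs` identities summed against `U`:
`t` was chosen so that the derivative of the equation vanishes identically. -/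
theorem constr_parallel {t : Fin 4 → Fin 6 → ℂ × ℂ → ℂ} {q : ℂ × ℂ}
    (hat : Prolongs (fun k => a k q) (fun k => pd (1, 0) (a k) q) (fun k => pd (0, 1) (a k) q)
        (fun i k => t i k q))
    (w : ℂ × ℂ) (U : Fin 6 → ℂ) :
    ∑ k, fderiv ℂ (a k) q w * U k + ∑ k, a k q * conn t q w U k = 0 := by
  have hl := hat.left
  have hr := hat.right
  simp only [fderiv_eq_pd, conn_apply]
  have eL : ∑ k, pd (1, 0) (a k) q * U k + ∑ k, a k q * shiftL (fun i k => t i k q) U k = 0 := by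
    have : ∑ k, (a 3 q * t 0 k q + a 4 q * t 1 k q + a 5 q * t 2 k q +
      lowL (fun k => a k q) (fun k => pd (1, 0) (a k) q) k) * U k = 0 :=
      Finset.sum_eq_zero fun k _ => by rw [hl k, zero_mul]
    refine Eq.trans ?_ this
    simp [Fin.sum_univ_succ, shiftL, lowL]
    ring
  have eM : ∑ k, pd (0, 1) (a k) q * U k + ∑ k, a k q * shiftM (fun i k => t i k q) U k = 0 := by
    have : ∑ k, (a 3 q * t 1 k q + a 4 q * t 2 k q + a 5 q * t 3 k q +
      lowM (fun k => a k q) (fun k => pd (0, 1) (a k) q) k) * U k = 0 :=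
      Finset.sum_eq_zero fun k _ => by rw [hr k, zero_mul]
    refine Eq.trans ?_ this
    simp [Fin.sum_univ_succ, shiftM, lowM]
    ring
  have : ∀ k, a k q * (w.1 * shiftL (fun i k => t i k q) U k +
      w.2 * shiftM (fun i k => t i k q) U k) = w.1 * (a k q * shiftL (fun i k => t i k q) U k) +
      w.2 * (a k q * shiftM (fun i k => t i k q) U k) := fun k => by ring
  simp only [this, add_mul, Finset.sum_add_distrib, mul_assoc, ← Finset.mul_sum]
  linear_combination w.1 * eL + w.2 * eM

theorem analyticAt_shiftL {t : Fin 4 → Fin 6 → ℂ × ℂ → ℂ} {U : Fin 6 → ℂ × ℂ → ℂ} {q : ℂ × ℂ}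
    (ht : ∀ i k, AnalyticAt ℂ (t i k) q) (hU : ∀ k, AnalyticAt ℂ (U k) q) (k : Fin 6) :
    AnalyticAt ℂ (fun z => shiftL (fun i k => t i k z) (fun k => U k z) k) q := by
  have hs : ∀ i, AnalyticAt ℂ (fun z => ∑ k, t i k z * U k z) q := fun i =>
    Finset.analyticAt_fun_sum _ fun k _ => (ht i k).mul (hU k)
  fin_cases k
  · exact hU 1
  · exact hU 3
  · exact hU 4
  · exact hs 0
  · exact hs 1
  · exact hs 2

theorem analyticAt_shiftM {t : Fin 4 → Fin 6 → ℂ × ℂ → ℂ} {U : Fin 6 → ℂ × ℂ → ℂ} {q : ℂ × ℂ}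
    (ht : ∀ i k, AnalyticAt ℂ (t i k) q) (hU : ∀ k, AnalyticAt ℂ (U k) q) (k : Fin 6) :
    AnalyticAt ℂ (fun z => shiftM (fun i k => t i k z) (fun k => U k z) k) q := by
  have hs : ∀ i, AnalyticAt ℂ (fun z => ∑ k, t i k z * U k z) q := fun i =>
    Finset.analyticAt_fun_sum _ fun k _ => (ht i k).mul (hU k)
  fin_cases k
  · exact hU 2
  · exact hU 4
  · exact hU 5
  · exact hs 1
  · exact hs 2
  · exact hs 3

theorem sum_germs_mul_jetG {s : Fin 6 → ℂ × ℂ → ℂ} {q : ℂ × ℂ} (hs : ∀ k, AnalyticAt ℂ (s k) q)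
    {u : ℂ × ℂ → ℂ} (hu : AnalyticAt ℂ u q) :
    ∑ k, germs hs k * jetG q (HolGerm.of u hu) k = HolGerm.of (fun z => ∑ k, s k z * jet u k z)
      (Finset.analyticAt_fun_sum _ fun k _ => (hs k).mul (analyticAt_jet hu k)) :=
  opG_of hs hu

theorem shiftL_germs {t : Fin 4 → Fin 6 → ℂ × ℂ → ℂ} {q : ℂ × ℂ}
    (ht : ∀ i k, AnalyticAt ℂ (t i k) q) {u : ℂ × ℂ → ℂ} (hu : AnalyticAt ℂ u q) (k : Fin 6) :
    shiftL (fun i k => germs (ht i) k) (jetG q (HolGerm.of u hu)) k =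
      HolGerm.of _ (analyticAt_shiftL ht (fun k => analyticAt_jet hu k) k) := by
  fin_cases k
  · rfl
  · rfl
  · rfl
  · exact sum_germs_mul_jetG (ht 0) hu
  · exact sum_germs_mul_jetG (ht 1) hu
  · exact sum_germs_mul_jetG (ht 2) hu

theorem shiftM_germs {t : Fin 4 → Fin 6 → ℂ × ℂ → ℂ} {q : ℂ × ℂ}
    (ht : ∀ i k, AnalyticAt ℂ (t i k) q) {u : ℂ × ℂ → ℂ} (hu : AnalyticAt ℂ u q) (k : Fin 6) :
    shiftM (fun i k => germs (ht i) k) (jetG q (HolGerm.of u hu)) k =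
      HolGerm.of _ (analyticAt_shiftM ht (fun k => analyticAt_jet hu k) k) := by
  fin_cases k
  · rfl
  · rfl
  · rfl
  · exact sum_germs_mul_jetG (ht 1) hu
  · exact sum_germs_mul_jetG (ht 2) hu
  · exact sum_germs_mul_jetG (ht 3) hu

/-- The compatibility condition of the pair of equations with coefficients `a` and `b` at `q`. -/
def Compatible (a b : Fin 6 → ℂ × ℂ → ℂ) (ha : ∀ k q, AnalyticAt ℂ (a k) q)
    (hb : ∀ k q, AnalyticAt ℂ (b k) q) (q : ℂ × ℂ) : Prop :=
  ∀ g : HolGerm q, FlatAt q (opG q (germs fun k => ha k q) g) →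
    FlatAt q (opG q (germs fun k => hb k q) g) →
    HolGerm.ev q (opG q (germs fun k => hb k q) (opG q (germs fun k => ha k q) g)) =
      HolGerm.ev q (opG q (germs fun k => ha k q) (opG q (germs fun k => hb k q) g))

theorem ev_opG {q : ℂ × ℂ} (ha : ∀ k, AnalyticAt ℂ (a k) q) (g : HolGerm q) :
    HolGerm.ev q (opG q (germs ha) g) = ∑ k, a k q * HolGerm.ev q (jetG q g k) := by
  rw [opG, map_sum]
  simp only [map_mul]
  rfl

/-- A constrained jet `U` is extended to the jet of an actual germ. Its mixed derivatives commute,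
which leaves only the closedness of the defects at `q`; that is what the syzygy provides through
`ev_dm_defect`. -/
theorem conn_curvature (ha : ∀ k q, AnalyticAt ℂ (a k) q) (hb : ∀ k q, AnalyticAt ℂ (b k) q)
    {t : Fin 4 → Fin 6 → ℂ × ℂ → ℂ} {q : ℂ × ℂ}
    (hres : symbolRes (fun k => a k q) (fun k => b k q) ≠ 0)
    (ht : ∀ i k, AnalyticAt ℂ (t i k) q)
    (hat : Prolongs (germs fun k => ha k q) (fun k => dl q (germs (fun k => ha k q) k))
      (fun k => dm q (germs (fun k => ha k q) k)) (fun i k => germs (ht i) k))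
    (hbt : Prolongs (germs fun k => hb k q) (fun k => dl q (germs (fun k => hb k q) k))
      (fun k => dm q (germs (fun k => hb k q) k)) (fun i k => germs (ht i) k))
    (hc : Compatible a b ha hb q) {U : Fin 6 → ℂ} (hU : constr a b q U = 0) (v w : ℂ × ℂ) :
    fderiv ℂ (conn t) q v w U + conn t q w (conn t q v U) =
      fderiv ℂ (conn t) q w v U + conn t q v (conn t q w U) := by
  -- The third derivatives of `g` at `q` are taken to be the prescribed ones, so all defects vanish
  -- at `q`.
  obtain ⟨g, hg, hg3⟩ := exists_jet q U (fun i => ∑ k, t i k q * U k)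
  rw [constr_apply, Prod.mk_eq_zero] at hU
  have hd : ∀ i, HolGerm.ev q (defect (fun i k => germs (ht i) k) g i) = 0 := by
    intro i
    rw [defect, map_sub, hg3, map_sum, sub_eq_zero]
    refine Finset.sum_congr rfl fun k _ => ?_
    rw [map_mul, hg]
    rfl
  have key := ev_dm_defect hat hbt hres (hc g) (by rw [ev_opG]; simpa only [hg] using hU.1)
    (by rw [ev_opG]; simpa only [hg] using hU.2) hd
  obtain ⟨u, hu, rfl⟩ := HolGerm.exists_of g
  have hjet : (fun k => jet u k q) = U := funext fun k => by rw [← hg k, jetG_of]; rfl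
  rw [← hjet]
  have hj := fun k => analyticAt_jet hu k
  refine curvature_eq (S := fun z k => jet u k z) (analyticAt_conn ht).differentiableAt
    (differentiableAt_pi.2 fun k => (hj k).differentiableAt) (jet_flat hu ht hd) ?_ v w
  -- closedness
  set T : Fin 4 → Fin 6 → HolGerm q := fun i k => germs (ht i) k with hT
  set g : HolGerm q := HolGerm.of u hu with hgdef
  have hcl : ∀ k, HolGerm.ev q (dm q (shiftL T (jetG q g) k)) =
      HolGerm.ev q (dl q (shiftM T (jetG q g) k)) := by
    intro k
    -- The derivative of a jet is the shift plus the defects. Comparing the two orders of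
    -- differentiation, the shifts are closed at `q` exactly when the defects are, and the latter is
    -- `key`.
    have e1 := congrArg (fun h => HolGerm.ev q (dm q h)) (dl_jetG T g k)
    have e2 := congrArg (fun h => HolGerm.ev q (dl q h)) (dm_jetG T g k)
    simp only [map_add, dm_dl] at e1 e2
    rw [e1] at e2
    have e3 : HolGerm.ev q (dm q ((![0, 0, 0, defect T g 0, defect T g 1, defect T g 2] :
          Fin 6 → HolGerm q) k)) =
        HolGerm.ev q (dl q ((![0, 0, 0, defect T g 1, defect T g 2, defect T g 3] :
          Fin 6 → HolGerm q) k)) := by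
      have k0 := key 0
      have k1 := key 1
      have k2 := key 2
      fin_cases k
      · simp
      · simp
      · simp
      · exact k0
      · exact k1
      · exact k2
    rw [e3] at e2
    exact add_right_cancel e2
  intro v w
  have hX := analyticAt_shiftL ht hj
  have hM := analyticAt_shiftM ht hj
  have hform : ∀ w : ℂ × ℂ, (fun z => conn t z w (fun k => jet u k z)) =
      fun z k => w.1 * shiftL (fun i k => t i k z) (fun k => jet u k z) k +
        w.2 * shiftM (fun i k => t i k z) (fun k => jet u k z) k :=
    fun w => funext fun z => funext fun k => conn_apply _ _ _ _ _
  have hdiff : ∀ (w : ℂ × ℂ) k, DifferentiableAt ℂ (fun z =>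
      w.1 * shiftL (fun i k => t i k z) (fun k => jet u k z) k +
        w.2 * shiftM (fun i k => t i k z) (fun k => jet u k z) k) q := fun w k =>
    ((hX k).differentiableAt.const_mul _).add ((hM k).differentiableAt.const_mul _)
  rw [hform, hform, fderiv_pi (hdiff w), fderiv_pi (hdiff v)]
  ext k
  have hk := hcl k
  have eX : shiftL T (jetG q g) k = HolGerm.of _ (hX k) := shiftL_germs ht hu k
  have eM : shiftM T (jetG q g) k = HolGerm.of _ (hM k) := shiftM_germs ht hu k
  rw [eX, eM] at hk
  change pd (0, 1) _ q = pd (1, 0) _ q at hk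
  rw [ContinuousLinearMap.pi_apply, ContinuousLinearMap.pi_apply,
    fderiv_fun_add ((hX k).differentiableAt.const_mul _) ((hM k).differentiableAt.const_mul _),
    fderiv_fun_add ((hX k).differentiableAt.const_mul _) ((hM k).differentiableAt.const_mul _),
    fderiv_const_mul (hX k).differentiableAt, fderiv_const_mul (hM k).differentiableAt,
    fderiv_const_mul (hX k).differentiableAt, fderiv_const_mul (hM k).differentiableAt]
  simp only [add_apply, smul_apply, smul_eq_mul, fderiv_eq_pd _ q v, fderiv_eq_pd _ q w]
  -- Both sides are bilinear in `v`, `w`, and their difference is antisymmetric: a single scalar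
  -- identity `hk` suffices, weighted by the 2×2 determinant.
  linear_combination (v.2 * w.1 - v.1 * w.2) * hk

end System

end PeriodDE

/-! ### The dimension of the local solution space of a compatible pair. -/

namespace PeriodDE

section System

variable {a b : Fin 6 → ℂ × ℂ → ℂ}

theorem constr_surjective {q : ℂ × ℂ} (hres : symbolRes (fun k => a k q) (fun k => b k q) ≠ 0) :
    Function.Surjective (constr a b q) := by
  have key : ∀ i j : Fin 6, i ≠ j → a i q * b j q - a j q * b i q ≠ 0 →
      Function.Surjective (constr a b q) := by
    intro i j hij hne y
    refine ⟨Pi.single i ((y.1 * b j q - a j q * y.2) / (a i q * b j q - a j q * b i q)) +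
      Pi.single j ((a i q * y.2 - y.1 * b i q) / (a i q * b j q - a j q * b i q)), ?_⟩
    rw [constr_apply]
    simp only [Pi.add_apply, mul_add, Finset.sum_add_distrib, Pi.single_apply, mul_ite, mul_zero,
      Finset.sum_ite_eq', Finset.mem_univ, if_true]
    refine Prod.ext ?_ ?_ <;> dsimp only
    · rw [← mul_div_assoc, ← mul_div_assoc, ← add_div, div_eq_iff hne]
      ring
    · rw [← mul_div_assoc, ← mul_div_assoc, ← add_div, div_eq_iff hne]
      ring
  -- If the two constraint rows were dependent, the minors for the columns `3, 5` and `3, 4` would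
  -- vanish, and with them the resultant.
  by_contra h
  have h35 : a 3 q * b 5 q - a 5 q * b 3 q = 0 := by
    by_contra h'
    exact h (key 3 5 (by decide) h')
  have h34 : a 3 q * b 4 q - a 4 q * b 3 q = 0 := by
    by_contra h'
    exact h (key 3 4 (by decide) h')
  exact hres (by simp [symbolRes, h35, h34])

theorem finrank_ker_constr {q : ℂ × ℂ}
    (hres : symbolRes (fun k => a k q) (fun k => b k q) ≠ 0) :
    Module.finrank ℂ (LinearMap.ker (constr a b q : (Fin 6 → ℂ) →ₗ[ℂ] ℂ × ℂ)) = 4 := by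
  have h := LinearMap.finrank_range_add_finrank_ker (constr a b q : (Fin 6 → ℂ) →ₗ[ℂ] ℂ × ℂ)
  have h1 : LinearMap.range (constr a b q : (Fin 6 → ℂ) →ₗ[ℂ] ℂ × ℂ) = ⊤ :=
    LinearMap.range_eq_top.2 (constr_surjective hres)
  rw [h1, finrank_top] at h
  simp at h
  omega

/-- The value of the jet of order two of a germ, as a linear map. -/
noncomputable def jetMap (p : ℂ × ℂ) : HolGerm p →ₗ[ℂ] (Fin 6 → ℂ) where
  toFun g k := HolGerm.ev p (jetG p g k)
  map_add' g h := by
    ext k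
    fin_cases k <;> simp [jetG]
  map_smul' c g := by
    have hc : ∀ h : HolGerm p, HolGerm.ev p (c • h) = c * HolGerm.ev p h := fun h => by
      rw [HolGerm.smul_eq_const_mul, map_mul]
      rfl
    ext k
    fin_cases k <;> simp [jetG, hc]

/-- Local structure of a compatible pair of second order equations without common characteristics:
the jet of order two at the base point is an isomorphism from the space of solutions onto the space
of jets which satisfy the equations. -/
theorem finrank_solutions_eq_four (ha : ∀ k q, AnalyticAt ℂ (a k) q)
    (hb : ∀ k q, AnalyticAt ℂ (b k) q) (hc : ∀ q, Compatible a b ha hb q) {p : ℂ × ℂ}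
    (hres : symbolRes (fun k => a k p) (fun k => b k p) ≠ 0) (S : Submodule ℂ (HolGerm p))
    (hS : ∀ g, g ∈ S ↔ opG p (germs fun k => ha k p) g = 0 ∧ opG p (germs fun k => hb k p) g = 0) :
    Module.finrank ℂ S = 4 := by
  obtain ⟨t, ht⟩ := exists_prolongation ha hb
  have hresan : ∀ q, AnalyticAt ℂ (fun q => symbolRes (fun k => a k q) (fun k => b k q)) q := by
    intro q
    have h := fun k => ha k q
    have h' := fun k => hb k q
    exact ((((h 3).mul (h' 5)).sub ((h 5).mul (h' 3))).pow 2).sub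
      ((((h 3).mul (h' 4)).sub ((h 4).mul (h' 3))).mul (((h 4).mul (h' 5)).sub ((h 5).mul (h' 4))))
  have hne : ∀ᶠ q in 𝓝 p, symbolRes (fun k => a k q) (fun k => b k q) ≠ 0 :=
    (hresan p).continuousAt.eventually_ne hres
  have hgerm : ∀ᶠ q in 𝓝 p, ∃ htq : ∀ i k, AnalyticAt ℂ (t i k) q,
      Prolongs (germs fun k => ha k q) (fun k => dl q (germs (fun k => ha k q) k))
        (fun k => dm q (germs (fun k => ha k q) k)) (fun i k => germs (htq i) k) ∧
      Prolongs (germs fun k => hb k q) (fun k => dl q (germs (fun k => hb k q) k))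
        (fun k => dm q (germs (fun k => hb k q) k)) (fun i k => germs (htq i) k) := by
    filter_upwards [hne.eventually_nhds] with q hq
    exact ⟨(ht q hq.self_of_nhds).1,
      prolongs_germs _ _ (hq.mono fun z hz => (ht z hz).2.1),
      prolongs_germs _ _ (hq.mono fun z hz => (ht z hz).2.2)⟩
  obtain ⟨htp, hatp, hbtp⟩ := hgerm.self_of_nhds
  -- Near `p` the derivatives of both equations force all defects of a solution to vanish, so its
  -- jet is a flat section. Together with `flat_section_unique` this gives injectivity of `J`.
  have hflat : ∀ (u : ℂ × ℂ → ℂ) (hu : AnalyticAt ℂ u p), HolGerm.of u hu ∈ S →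
      ∀ᶠ q in 𝓝 p, ∀ w, fderiv ℂ (fun z k => jet u k z) q w =
        conn t q w (fun k => jet u k q) := by
    intro u hu huS
    obtain ⟨h1, h2⟩ := (hS _).1 huS
    have h1' := (HolGerm.of_eq_of (hv := analyticAt_const)).1 ((opG_of _ hu).symm.trans h1)
    have h2' := (HolGerm.of_eq_of (hv := analyticAt_const)).1 ((opG_of _ hu).symm.trans h2)
    filter_upwards [hgerm, hne, h1'.eventually_nhds, h2'.eventually_nhds,
      hu.eventually_analyticAt] with q hq hqne hq1 hq2 huq
    obtain ⟨htq, hatq, hbtq⟩ := hq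
    have hd := defect_eq_zero hatq hbtq (g := HolGerm.of u huq) hqne
      ((opG_of _ huq).trans ((HolGerm.of_eq_of (hv := analyticAt_const)).2 hq1))
      ((opG_of _ huq).trans ((HolGerm.of_eq_of (hv := analyticAt_const)).2 hq2))
    exact jet_flat huq htq fun i => by rw [hd]; exact map_zero _
  let J : S →ₗ[ℂ] LinearMap.ker (constr a b p : (Fin 6 → ℂ) →ₗ[ℂ] ℂ × ℂ) :=
    ((jetMap p).comp S.subtype).codRestrict _ fun g => by
      obtain ⟨h1, h2⟩ := (hS _).1 g.2
      have e1 := congrArg (HolGerm.ev p) h1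
      have e2 := congrArg (HolGerm.ev p) h2
      rw [ev_opG, map_zero] at e1 e2
      rw [LinearMap.mem_ker]
      exact (constr_apply _ _).trans (Prod.ext e1 e2)
  have hinj : Function.Injective J := by
    rw [injective_iff_map_eq_zero]
    rintro ⟨g, hg⟩ h0
    obtain ⟨u, hu, rfl⟩ := HolGerm.exists_of g
    have hU0 : (fun k => jet u k p) = 0 := by
      have := congrArg Subtype.val h0
      refine Eq.trans (funext fun k => ?_) this
      change _ = HolGerm.ev p (jetG p (HolGerm.of u hu) k)
      rw [jetG_of]
      rfl
    have := flat_section_unique (analyticAt_conn htp)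
      (analyticAt_pi_iff.2 fun k => analyticAt_jet hu k) (hflat u hu hg) hU0
    refine Subtype.ext ((HolGerm.of_eq_of (hu := hu) (hv := analyticAt_const)).2 ?_)
    exact this.mono fun q hq => congrFun hq 0
  have hsurj : Function.Surjective J := by
    rintro ⟨U₀, hU₀⟩
    obtain ⟨U, hU, hUp, hUc, hUf⟩ := exists_flat_section (analyticAt_conn htp)
      (analyticAt_constr (fun k => ha k p) fun k => hb k p)
      (hne.mono fun q hq w U => by
        rw [fderiv_constr_apply (fun k => ha k q) (fun k => hb k q), constr_apply]
        exact Prod.ext (constr_parallel (ht q hq).2.1 w U) (constr_parallel (ht q hq).2.2 w U))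
      ((hne.and hgerm).mono fun q hq U hU v w => by
        obtain ⟨hq1, htq, h1, h2⟩ := hq
        exact conn_curvature ha hb hq1 htq h1 h2 (hc q) hU v w)
      (U₀ := U₀) hU₀
    have hUk : ∀ k, AnalyticAt ℂ (fun q => U q k) p := analyticAt_pi_iff.1 hU
    have hpd : ∀ᶠ q in 𝓝 p, ∀ k, pd (1, 0) (fun z => U z k) q =
          shiftL (fun i k => t i k q) (U q) k ∧
        pd (0, 1) (fun z => U z k) q = shiftM (fun i k => t i k q) (U q) k := by
      filter_upwards [hUf, hU.eventually_analyticAt] with q hq hUq k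
      have h1 : ∀ w, fderiv ℂ (fun z => U z k) q w = conn t q w (U q) k := by
        intro w
        rw [← hq w, fderiv_apply hUq.differentiableAt]
        rfl
      constructor
      · rw [pd, h1, conn_apply]; simp
      · rw [pd, h1, conn_apply]; simp
    have hpd_congr : ∀ (v : ℂ × ℂ) {f g : ℂ × ℂ → ℂ}, f =ᶠ[𝓝 p] g → pd v f =ᶠ[𝓝 p] pd v g :=
      fun v f g h => (h.fderiv (𝕜 := ℂ)).fun_comp (fun A => A v)
    have hL : ∀ k, pd (1, 0) (fun z => U z k) =ᶠ[𝓝 p]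
        fun q => shiftL (fun i k => t i k q) (U q) k := fun k => hpd.mono fun q hq => (hq k).1
    have hM : ∀ k, pd (0, 1) (fun z => U z k) =ᶠ[𝓝 p]
        fun q => shiftM (fun i k => t i k q) (U q) k := fun k => hpd.mono fun q hq => (hq k).2
    -- The first three rows of the connection say that components 1 to 5 of a flat section are the
    -- successive derivatives of component 0. Hence the section is the jet of that component, and
    -- the constraints become the two equations.
    have hjet : ∀ k, jet (fun z => U z 0) k =ᶠ[𝓝 p] fun z => U z k := by
      intro k
      fin_cases k
      · exact EventuallyEq.rfl
      · exact hL 0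
      · exact hM 0
      · exact (hpd_congr _ (hL 0)).trans (hL 1)
      · exact (hpd_congr _ (hM 0)).trans (hL 2)
      · exact (hpd_congr _ (hM 0)).trans (hM 2)
    have hjet' : ∀ᶠ q in 𝓝 p, ∀ k, jet (fun z => U z 0) k q = U q k := eventually_all.2 hjet
    have hmem : HolGerm.of _ (hUk 0) ∈ S := by
      rw [hS]
      constructor
      · refine (opG_of _ _).trans ((HolGerm.of_eq_of (hv := analyticAt_const)).2 ?_)
        filter_upwards [hjet', hUc] with q h1 h2
        rw [constr_apply, Prod.mk_eq_zero] at h2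
        simpa only [h1] using h2.1
      · refine (opG_of _ _).trans ((HolGerm.of_eq_of (hv := analyticAt_const)).2 ?_)
        filter_upwards [hjet', hUc] with q h1 h2
        rw [constr_apply, Prod.mk_eq_zero] at h2
        simpa only [h1] using h2.2
    refine ⟨⟨_, hmem⟩, Subtype.ext (funext fun k => ?_)⟩
    change HolGerm.ev p (jetG p (HolGerm.of _ (hUk 0)) k) = U₀ k
    rw [jetG_of, HolGerm.ev_of, hjet'.self_of_nhds k, hUp]
  rw [(LinearEquiv.ofBijective J ⟨hinj, hsurj⟩).finrank_eq, finrank_ker_constr hres]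

end System

end PeriodDE

/-! ### The coefficients of the given operators as functions and as germs. -/

namespace PeriodDE

/-- The ring of functions which are holomorphic at `q`. -/
def holSubring (q : ℂ × ℂ) : Subring (ℂ × ℂ → ℂ) where
  carrier := {u | AnalyticAt ℂ u q}
  mul_mem' hu hv := hu.mul hv
  one_mem' := analyticAt_const
  add_mem' hu hv := hu.add hv
  zero_mem' := analyticAt_const
  neg_mem' hu := hu.neg

/-- Taking germs, as a ring homomorphism. -/
noncomputable def germHom (q : ℂ × ℂ) : holSubring q →+* HolGerm q where
  toFun u := HolGerm.of u.1 u.2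
  map_one' := rfl
  map_mul' _ _ := rfl
  map_zero' := rfl
  map_add' _ _ := rfl

/-- The coefficients are polynomials over any commutative ring. Naturality lets the same formula be
evaluated at numbers, at functions holomorphic at `q` (analyticity is then membership in `holSubring
q`) and at germs, with agreement between the three. -/
theorem map_coefD1 {R S : Type*} [CommRing R] [CommRing S] (f : R →+* S) (c l m : R) (j : Fin 4)
    (k : Fin 6) : f (coefD1 c l m j k) = coefD1 (f c) (f l) (f m) j k := by
  fin_cases j <;> fin_cases k <;> simp [coefD1, map_ofNat f]

theorem map_coefD3 {R S : Type*} [CommRing R] [CommRing S] (f : R →+* S) (c l m : R) (j : Fin 4)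
    (k : Fin 6) : f (coefD3 c l m j k) = coefD3 (f c) (f l) (f m) j k := by
  fin_cases j <;> fin_cases k <;> simp [coefD3, map_ofNat f]

theorem holSubring_coefD1 (j : Fin 4) (k : Fin 6) (q : ℂ × ℂ) :
    (coefD1 (R := holSubring q) ⟨fun _ => 1 / 27, analyticAt_const⟩ ⟨Prod.fst, analyticAt_fst⟩
      ⟨Prod.snd, analyticAt_snd⟩ j k).1 = fun z => coefD1 (1 / 27 : ℂ) z.1 z.2 j k := by
  funext z
  exact map_coefD1 ((Pi.evalRingHom (fun _ : ℂ × ℂ => ℂ) z).comp (holSubring q).subtype) _ _ _ j k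

theorem analyticAt_coefD1 (j : Fin 4) (k : Fin 6) (q : ℂ × ℂ) :
    AnalyticAt ℂ (fun z : ℂ × ℂ => coefD1 (1 / 27 : ℂ) z.1 z.2 j k) q :=
  holSubring_coefD1 j k q ▸ (coefD1 (R := holSubring q) _ _ _ j k).2

theorem coefD1_germs (j : Fin 4) (q : ℂ × ℂ) :
    coefD1 (HolGerm.const q (1 / 27)) (lamG q) (muG q) j =
      germs fun k => analyticAt_coefD1 j k q := by
  ext1 k
  refine (map_coefD1 (germHom q) ⟨fun _ => 1 / 27, analyticAt_const⟩ ⟨Prod.fst, analyticAt_fst⟩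
    ⟨Prod.snd, analyticAt_snd⟩ j k).symm.trans ?_
  exact (HolGerm.of_eq_of (hu := (coefD1 (R := holSubring q) _ _ _ j k).2)).2
    (Eventually.of_forall fun z => congrFun (holSubring_coefD1 j k q) z)

theorem holSubring_coefD3 (j : Fin 4) (k : Fin 6) (q : ℂ × ℂ) :
    (coefD3 (R := holSubring q) ⟨fun _ => 1 / 27, analyticAt_const⟩ ⟨Prod.fst, analyticAt_fst⟩
      ⟨Prod.snd, analyticAt_snd⟩ j k).1 = fun z => coefD3 (1 / 27 : ℂ) z.1 z.2 j k := by
  funext z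
  exact map_coefD3 ((Pi.evalRingHom (fun _ : ℂ × ℂ => ℂ) z).comp (holSubring q).subtype) _ _ _ j k

theorem analyticAt_coefD3 (j : Fin 4) (k : Fin 6) (q : ℂ × ℂ) :
    AnalyticAt ℂ (fun z : ℂ × ℂ => coefD3 (1 / 27 : ℂ) z.1 z.2 j k) q :=
  holSubring_coefD3 j k q ▸ (coefD3 (R := holSubring q) _ _ _ j k).2

theorem coefD3_germs (j : Fin 4) (q : ℂ × ℂ) :
    coefD3 (HolGerm.const q (1 / 27)) (lamG q) (muG q) j =
      germs fun k => analyticAt_coefD3 j k q := by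
  ext1 k
  refine (map_coefD3 (germHom q) ⟨fun _ => 1 / 27, analyticAt_const⟩ ⟨Prod.fst, analyticAt_fst⟩
    ⟨Prod.snd, analyticAt_snd⟩ j k).symm.trans ?_
  exact (HolGerm.of_eq_of (hu := (coefD3 (R := holSubring q) _ _ _ j k).2)).2
    (Eventually.of_forall fun z => congrFun (holSubring_coefD3 j k q) z)

theorem finrank_solutions (j : Fin 4) {p : ℂ × ℂ} (hp : p ∈ Lambda j) :
    Module.finrank ℂ (solutions p j) = 4 := by
  refine finrank_solutions_eq_four (analyticAt_coefD1 j) (analyticAt_coefD3 j) (fun q g h1 h3 => ?_)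
    (symbolRes_ne_zero j hp) _ (fun g => ?_)
  · rw [← coefD1_germs] at *
    rw [← coefD3_germs] at *
    simp only [← D1_apply, ← D3_apply] at *
    exact ev_D3_D1 q j g h1 h3
  · rw [← coefD1_germs, ← coefD3_germs, ← D1_apply, ← D3_apply]
    rfl

end PeriodDE

/-! ### Convergent double power series and the action of the operators on coefficients. -/

namespace PeriodDE

/-- The double series with a positive radius of absolute convergence. -/
def convSeries : Submodule ℂ (ℕ × ℕ → ℂ) where
  carrier := {c | ∃ r : ℝ, 0 < r ∧ Summable fun k : ℕ × ℕ => ‖c k‖ * r ^ (k.1 + k.2)}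
  zero_mem' := ⟨1, one_pos, by simp⟩
  add_mem' := by
    rintro c d ⟨r, hr, hc⟩ ⟨s, hs, hd⟩
    refine ⟨min r s, lt_min hr hs, (hc.add hd).of_nonneg_of_le (fun k => by positivity) fun k => ?_⟩
    calc ‖c k + d k‖ * min r s ^ (k.1 + k.2)
        ≤ (‖c k‖ + ‖d k‖) * min r s ^ (k.1 + k.2) := by gcongr; exact norm_add_le _ _
      _ = ‖c k‖ * min r s ^ (k.1 + k.2) + ‖d k‖ * min r s ^ (k.1 + k.2) := add_mul _ _ _
      _ ≤ _ := by
        gcongr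
        · exact min_le_left _ _
        · exact min_le_right _ _
  smul_mem' := by
    rintro z c ⟨r, hr, hc⟩
    refine ⟨r, hr, (hc.mul_left ‖z‖).congr fun k => ?_⟩
    simp [mul_assoc]

/-- The sum of a double power series. -/
noncomputable def seriesSum (c : ℕ × ℕ → ℂ) (p : ℂ × ℂ) : ℂ :=
  ∑' k : ℕ × ℕ, c k * p.1 ^ k.1 * p.2 ^ k.2

theorem norm_term_le (c : ℕ × ℕ → ℂ) {p : ℂ × ℂ} {r : ℝ} (hp : ‖p‖ ≤ r) (k : ℕ × ℕ) :
    ‖c k * p.1 ^ k.1 * p.2 ^ k.2‖ ≤ ‖c k‖ * r ^ (k.1 + k.2) := by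
  rw [norm_mul, norm_mul, norm_pow, norm_pow, mul_assoc, pow_add]
  have h0 : 0 ≤ r := (norm_nonneg p).trans hp
  gcongr
  · exact (norm_fst_le p).trans hp
  · exact (norm_snd_le p).trans hp

theorem summable_term {c : ℕ × ℕ → ℂ} {r : ℝ}
    (hc : Summable fun k : ℕ × ℕ => ‖c k‖ * r ^ (k.1 + k.2)) {p : ℂ × ℂ} (hp : ‖p‖ ≤ r) :
    Summable fun k : ℕ × ℕ => c k * p.1 ^ k.1 * p.2 ^ k.2 :=
  Summable.of_norm_bounded hc (norm_term_le c hp)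

theorem eventually_summable {c : ℕ × ℕ → ℂ} (hc : c ∈ convSeries) :
    ∀ᶠ p : ℂ × ℂ in 𝓝 0, Summable fun k : ℕ × ℕ => c k * p.1 ^ k.1 * p.2 ^ k.2 := by
  obtain ⟨r, hr, hc⟩ := hc
  filter_upwards [Metric.closedBall_mem_nhds (0 : ℂ × ℂ) hr] with p hp
  exact summable_term hc (by simpa using hp)

/-- The multilinear form whose diagonal is `(x, y) ↦ x ^ i * y ^ (k - i)`. -/
noncomputable def monomialForm (k i : ℕ) :
    ContinuousMultilinearMap ℂ (fun _ : Fin k => ℂ × ℂ) ℂ :=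
  (ContinuousMultilinearMap.mkPiAlgebra ℂ (Fin k) ℂ).compContinuousLinearMap fun j =>
    if j.1 < i then ContinuousLinearMap.fst ℂ ℂ ℂ else ContinuousLinearMap.snd ℂ ℂ ℂ

theorem norm_monomialForm_le (k i : ℕ) : ‖monomialForm k i‖ ≤ 1 := by
  refine (ContinuousMultilinearMap.norm_compContinuousLinearMap_le _ _).trans ?_
  rw [ContinuousMultilinearMap.norm_mkPiAlgebra, one_mul]
  refine Finset.prod_le_one (fun _ _ => norm_nonneg _) fun j _ => ?_
  split_ifs
  · exact ContinuousLinearMap.norm_fst_le ℂ ℂ ℂ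
  · exact ContinuousLinearMap.norm_snd_le ℂ ℂ ℂ

theorem monomialForm_diag (i j : ℕ) (p : ℂ × ℂ) :
    monomialForm (i + j) i (fun _ => p) = p.1 ^ i * p.2 ^ j := by
  have h : monomialForm (i + j) i (fun _ => p) =
      ∏ t : Fin (i + j), if t.1 < i then p.1 else p.2 := by
    simp only [monomialForm, ContinuousMultilinearMap.compContinuousLinearMap_apply,
      ContinuousMultilinearMap.mkPiAlgebra_apply]
    refine Finset.prod_congr rfl fun t _ => ?_
    split_ifs <;> rfl
  rw [h, Fin.prod_univ_add]
  simp

theorem hasSum_sum_antidiagonal {E : Type*} [NormedAddCommGroup E] {f : ℕ × ℕ → E}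
    (hf : Summable f) :
    HasSum (fun n => ∑ x ∈ Finset.HasAntidiagonal.antidiagonal n, f x) (∑' k, f k) := by
  have h := (Finset.HasAntidiagonal.sigmaAntidiagonalEquivProd (A := ℕ)).hasSum_iff.2 hf.hasSum
  exact (h.sigma fun n => hasSum_fintype _).congr_fun fun n => (Finset.sum_coe_sort _ f).symm

/-- The double series is regrouped by total degree. The forms `monomialForm` are not symmetric, but
a power series expansion only sees their diagonals. -/
theorem analyticAt_seriesSum {c : ℕ × ℕ → ℂ} (hc : c ∈ convSeries) :
    AnalyticAt ℂ (seriesSum c) 0 := by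
  obtain ⟨r, hr, hc⟩ := hc
  lift r to NNReal using hr.le
  let P : FormalMultilinearSeries ℂ (ℂ × ℂ) ℂ := fun k =>
    ∑ x ∈ Finset.HasAntidiagonal.antidiagonal k, c x • monomialForm k x.1
  refine ⟨P, r, ?_, by exact_mod_cast hr, ?_⟩
  · refine P.le_radius_of_summable_norm ((hasSum_sum_antidiagonal hc).summable.of_nonneg_of_le
      (fun n => by positivity) fun n => ?_)
    calc ‖P n‖ * (r : ℝ) ^ n
        ≤ (∑ x ∈ Finset.HasAntidiagonal.antidiagonal n, ‖c x‖) * (r : ℝ) ^ n := by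
          gcongr
          refine norm_sum_le_of_le _ fun x _ => ?_
          rw [norm_smul]
          exact mul_le_of_le_one_right (norm_nonneg _) (norm_monomialForm_le _ _)
      _ = _ := by
          rw [Finset.sum_mul]
          refine Finset.sum_congr rfl fun x hx => ?_
          rw [Finset.HasAntidiagonal.mem_antidiagonal.1 hx]
  · intro y hy
    have hy : ‖y‖ ≤ (r : ℝ) := by
      exact_mod_cast (show ‖y‖₊ ≤ r by simpa using (Metric.mem_eball.1 hy).le)
    rw [zero_add]
    refine (hasSum_sum_antidiagonal (summable_term hc hy)).congr_fun fun n => ?_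
    rw [sum_apply]
    refine Finset.sum_congr rfl fun x hx => ?_
    obtain rfl := Finset.HasAntidiagonal.mem_antidiagonal.1 hx
    rw [smul_apply, monomialForm_diag, smul_eq_mul, mul_assoc]

theorem hasFDerivAt_term (c : ℂ) (k : ℕ × ℕ) (p : ℂ × ℂ) :
    HasFDerivAt (fun p : ℂ × ℂ => c * p.1 ^ k.1 * p.2 ^ k.2)
      ((c * (k.1 * p.1 ^ (k.1 - 1)) * p.2 ^ k.2) • ContinuousLinearMap.fst ℂ ℂ ℂ +
        (c * p.1 ^ k.1 * (k.2 * p.2 ^ (k.2 - 1))) • ContinuousLinearMap.snd ℂ ℂ ℂ) p := by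
  have h1 : HasFDerivAt (fun p : ℂ × ℂ => p.1) (ContinuousLinearMap.fst ℂ ℂ ℂ) p := hasFDerivAt_fst
  have h2 : HasFDerivAt (fun p : ℂ × ℂ => p.2) (ContinuousLinearMap.snd ℂ ℂ ℂ) p := hasFDerivAt_snd
  refine (((h1.pow k.1).const_mul c).mul (h2.pow k.2)).congr_fderiv ?_
  ext
  · simp
    ring
  · simp

/-- Since `n ≤ 2 ^ N`, the factor `n` produced by differentiation is absorbed by doubling the
radius. For `N = 0` the hypothesis forces `n = 0`, so the truncated exponent is harmless. -/
theorem natCast_mul_pow_pred_le {s : ℝ} (hs : 0 < s) (n N : ℕ) (hn : n ≤ N) :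
    n * s ^ (N - 1) ≤ s⁻¹ * (2 * s) ^ N := by
  rcases N with _ | N
  · obtain rfl : n = 0 := by omega
    simp [hs.le]
  · have h : (n : ℝ) ≤ 2 ^ (N + 1) := by
      exact_mod_cast hn.trans Nat.lt_two_pow_self.le
    calc (n : ℝ) * s ^ N ≤ 2 ^ (N + 1) * s ^ N := by gcongr
      _ = _ := by rw [mul_pow, pow_succ s]; field_simp

theorem hasFDerivAt_seriesSum {c : ℕ × ℕ → ℂ} (hc : c ∈ convSeries) :
    ∀ᶠ p : ℂ × ℂ in 𝓝 0, ∃ A : ℂ × ℂ →L[ℂ] ℂ, HasFDerivAt (seriesSum c) A p ∧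
      HasSum (fun k : ℕ × ℕ => c k * (k.1 * p.1 ^ (k.1 - 1)) * p.2 ^ k.2) (A (1, 0)) ∧
      HasSum (fun k : ℕ × ℕ => c k * p.1 ^ k.1 * (k.2 * p.2 ^ (k.2 - 1))) (A (0, 1)) := by
  obtain ⟨r, hr, hc⟩ := hc
  -- Halving the radius pays for the factors `k.1` and `k.2` of the termwise derivative.
  set s := r / 2 with hs
  have hs0 : 0 < s := by positivity
  have hrs : r = 2 * s := by rw [hs]; ring
  let f' : ℕ × ℕ → ℂ × ℂ → (ℂ × ℂ →L[ℂ] ℂ) := fun k p =>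
    (c k * (k.1 * p.1 ^ (k.1 - 1)) * p.2 ^ k.2) • ContinuousLinearMap.fst ℂ ℂ ℂ +
      (c k * p.1 ^ k.1 * (k.2 * p.2 ^ (k.2 - 1))) • ContinuousLinearMap.snd ℂ ℂ ℂ
  have hu : Summable fun k : ℕ × ℕ => 2 * s⁻¹ * (‖c k‖ * r ^ (k.1 + k.2)) := hc.mul_left _
  have hbound : ∀ k p, p ∈ Metric.ball (0 : ℂ × ℂ) s →
      ‖f' k p‖ ≤ 2 * s⁻¹ * (‖c k‖ * r ^ (k.1 + k.2)) := by
    intro k p hp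
    have hp : ‖p‖ ≤ s := by simpa using (Metric.mem_ball.1 hp).le
    have h1 : ‖p.1‖ ≤ s := (norm_fst_le p).trans hp
    have h2 : ‖p.2‖ ≤ s := (norm_snd_le p).trans hp
    have e1 : ‖c k * (k.1 * p.1 ^ (k.1 - 1)) * p.2 ^ k.2‖ ≤
        ‖c k‖ * (s⁻¹ * (2 * s) ^ (k.1 + k.2)) := by
      rw [norm_mul, norm_mul, norm_mul, norm_pow, norm_pow, mul_assoc, Complex.norm_natCast]
      refine mul_le_mul_of_nonneg_left ?_ (norm_nonneg _)
      refine le_trans ?_ (natCast_mul_pow_pred_le hs0 k.1 (k.1 + k.2) (by omega))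
      rcases Nat.eq_zero_or_pos k.1 with h | h
      · simp [h]
      · rw [show k.1 + k.2 - 1 = (k.1 - 1) + k.2 by omega, pow_add, mul_assoc]
        gcongr
    have e2 : ‖c k * p.1 ^ k.1 * (k.2 * p.2 ^ (k.2 - 1))‖ ≤
        ‖c k‖ * (s⁻¹ * (2 * s) ^ (k.1 + k.2)) := by
      rw [norm_mul, norm_mul, norm_mul, norm_pow, norm_pow, mul_assoc, Complex.norm_natCast]
      refine mul_le_mul_of_nonneg_left ?_ (norm_nonneg _)
      refine le_trans ?_ (natCast_mul_pow_pred_le hs0 k.2 (k.1 + k.2) (by omega))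
      rcases Nat.eq_zero_or_pos k.2 with h | h
      · simp [h]
      · rw [show k.1 + k.2 - 1 = k.1 + (k.2 - 1) by omega, pow_add, mul_left_comm]
        gcongr
    calc ‖f' k p‖ ≤ ‖c k * (k.1 * p.1 ^ (k.1 - 1)) * p.2 ^ k.2‖ * 1 +
          ‖c k * p.1 ^ k.1 * (k.2 * p.2 ^ (k.2 - 1))‖ * 1 := by
          refine (norm_add_le _ _).trans ?_
          rw [norm_smul, norm_smul]
          gcongr
          · exact ContinuousLinearMap.norm_fst_le ℂ ℂ ℂ
          · exact ContinuousLinearMap.norm_snd_le ℂ ℂ ℂ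
      _ ≤ ‖c k‖ * (s⁻¹ * (2 * s) ^ (k.1 + k.2)) * 1 +
          ‖c k‖ * (s⁻¹ * (2 * s) ^ (k.1 + k.2)) * 1 := by
          gcongr
      _ = _ := by rw [hrs]; ring
  filter_upwards [Metric.ball_mem_nhds (0 : ℂ × ℂ) hs0] with p hp
  have hS : Summable fun k => f' k p := Summable.of_norm_bounded hu fun k => hbound k p hp
  refine ⟨∑' k, f' k p, ?_, ?_, ?_⟩
  · exact hasFDerivAt_tsum_of_isPreconnected hu Metric.isOpen_ball
      (convex_ball _ _).isPreconnected (fun k q _ => hasFDerivAt_term (c k) k q) hbound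
      (Metric.mem_ball_self hs0) (summable_term hc (by simpa using hr.le)) hp
  · simpa [f'] using (ContinuousLinearMap.apply ℂ ℂ ((1, 0) : ℂ × ℂ)).hasSum hS.hasSum
  · simpa [f'] using (ContinuousLinearMap.apply ℂ ℂ ((0, 1) : ℂ × ℂ)).hasSum hS.hasSum

/-- The germ at the origin of the sum of a convergent double power series. -/
noncomputable def sumGerm : convSeries →ₗ[ℂ] HolGerm 0 where
  toFun c := HolGerm.of (seriesSum c) (analyticAt_seriesSum c.2)
  map_add' c d := by
    refine Eq.trans ?_ (HolGerm.of_add _ _).symm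
    refine HolGerm.of_eq_of.2 ?_
    filter_upwards [eventually_summable c.2, eventually_summable d.2] with p hc hd
    refine Eq.trans ?_ (hc.tsum_add hd)
    exact tsum_congr fun k => by simp [add_mul]
  map_smul' z c := by
    refine (HolGerm.of_eq_of (hu := analyticAt_seriesSum (z • c).2)
      (hv := analyticAt_const.mul (analyticAt_seriesSum c.2))).2 (Eventually.of_forall fun p => ?_)
    refine Eq.trans ?_ tsum_mul_left
    exact tsum_congr fun k => by simp [mul_assoc]

/-- As for termwise differentiation, a linear factor is at most `2 ^ (k.1 + k.2)` and costs half the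
radius. -/
theorem mul_natCast_mem_convSeries (f : ℕ × ℕ → ℕ) (hf : ∀ k, f k ≤ k.1 + k.2)
    {c : ℕ × ℕ → ℂ} (hc : c ∈ convSeries) : (fun k => (f k : ℂ) * c k) ∈ convSeries := by
  obtain ⟨r, hr, hc⟩ := hc
  refine ⟨r / 2, by positivity, hc.of_nonneg_of_le (fun k => by positivity) fun k => ?_⟩
  have h : (f k : ℝ) ≤ 2 ^ (k.1 + k.2) := by exact_mod_cast (hf k).trans Nat.lt_two_pow_self.le
  rw [norm_mul, Complex.norm_natCast, div_pow]
  calc (f k : ℝ) * ‖c k‖ * (r ^ (k.1 + k.2) / 2 ^ (k.1 + k.2))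
      ≤ 2 ^ (k.1 + k.2) * ‖c k‖ * (r ^ (k.1 + k.2) / 2 ^ (k.1 + k.2)) := by gcongr
    _ = _ := by field_simp

/-- The action of `thetaLam` on coefficients. -/
noncomputable def thetaLamCoeff : Module.End ℂ convSeries where
  toFun c := ⟨fun k => (k.1 : ℂ) * c.1 k, mul_natCast_mem_convSeries _ (by simp) c.2⟩
  map_add' c d := by ext k; simp [mul_add]
  map_smul' z c := by ext k; simp [mul_left_comm]

/-- The action of `thetaMu` on coefficients. -/
noncomputable def thetaMuCoeff : Module.End ℂ convSeries where
  toFun c := ⟨fun k => (k.2 : ℂ) * c.1 k, mul_natCast_mem_convSeries _ (by simp) c.2⟩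
  map_add' c d := by ext k; simp [mul_add]
  map_smul' z c := by ext k; simp [mul_left_comm]

theorem injective_succ_fst : Function.Injective fun k : ℕ × ℕ => (k.1 + 1, k.2) := by
  rintro ⟨a, b⟩ ⟨a', b'⟩ h
  simpa using h

theorem injective_succ_snd : Function.Injective fun k : ℕ × ℕ => (k.1, k.2 + 1) := by
  rintro ⟨a, b⟩ ⟨a', b'⟩ h
  simpa using h

theorem eq_zero_of_notMem_range_succ_fst {k : ℕ × ℕ}
    (hk : k ∉ Set.range fun k : ℕ × ℕ => (k.1 + 1, k.2)) : k.1 = 0 := by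
  by_contra h
  exact hk ⟨(k.1 - 1, k.2), by ext <;> simp; omega⟩

theorem eq_zero_of_notMem_range_succ_snd {k : ℕ × ℕ}
    (hk : k ∉ Set.range fun k : ℕ × ℕ => (k.1, k.2 + 1)) : k.2 = 0 := by
  by_contra h
  exact hk ⟨(k.1, k.2 - 1), by ext <;> simp; omega⟩

/-- The action of multiplication by `lam` on coefficients. -/
noncomputable def lamCoeff : Module.End ℂ convSeries where
  toFun c := ⟨fun k => if k.1 = 0 then 0 else c.1 (k.1 - 1, k.2), by
    obtain ⟨r, hr, hc⟩ := c.2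
    refine ⟨r, hr, (injective_succ_fst.summable_iff fun k hk => ?_).1 ((hc.mul_left r).congr ?_)⟩
    · simp [eq_zero_of_notMem_range_succ_fst hk]
    · intro k
      simp [add_right_comm _ 1, pow_succ]
      ring⟩
  map_add' c d := by ext k; by_cases h : k.1 = 0 <;> simp [h]
  map_smul' z c := by ext k; by_cases h : k.1 = 0 <;> simp [h]

/-- The action of multiplication by `mu` on coefficients. -/
noncomputable def muCoeff : Module.End ℂ convSeries where
  toFun c := ⟨fun k => if k.2 = 0 then 0 else c.1 (k.1, k.2 - 1), by
    obtain ⟨r, hr, hc⟩ := c.2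
    refine ⟨r, hr, (injective_succ_snd.summable_iff fun k hk => ?_).1 ((hc.mul_left r).congr ?_)⟩
    · simp [eq_zero_of_notMem_range_succ_snd hk]
    · intro k
      simp [← add_assoc, pow_succ]
      ring⟩
  map_add' c d := by ext k; by_cases h : k.2 = 0 <;> simp [h]
  map_smul' z c := by ext k; by_cases h : k.2 = 0 <;> simp [h]

theorem natCast_mul_pow (x : ℂ) (n : ℕ) : x * (n * x ^ (n - 1)) = n * x ^ n := by
  rcases n with _ | n
  · simp
  · rw [Nat.add_sub_cancel, pow_succ]
    ring

theorem thetaLam_sumGerm (c : convSeries) : thetaLam 0 (sumGerm c) = sumGerm (thetaLamCoeff c) := by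
  rw [thetaLam, Module.End.mul_apply]
  refine (HolGerm.of_eq_of (hu := analyticAt_fst.mul (analyticAt_pd (analyticAt_seriesSum c.2)))
    (hv := analyticAt_seriesSum (thetaLamCoeff c).2)).2 ?_
  filter_upwards [hasFDerivAt_seriesSum c.2] with p ⟨A, hA, h1, _⟩
  change p.1 * fderiv ℂ (seriesSum c) p (1, 0) = _
  rw [hA.fderiv, ← h1.tsum_eq, ← tsum_mul_left]
  refine tsum_congr fun k => ?_
  change _ = (k.1 : ℂ) * c.1 k * p.1 ^ k.1 * p.2 ^ k.2
  linear_combination c.1 k * p.2 ^ k.2 * natCast_mul_pow p.1 k.1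

theorem thetaMu_sumGerm (c : convSeries) : thetaMu 0 (sumGerm c) = sumGerm (thetaMuCoeff c) := by
  rw [thetaMu, Module.End.mul_apply]
  refine (HolGerm.of_eq_of (hu := analyticAt_snd.mul (analyticAt_pd (analyticAt_seriesSum c.2)))
    (hv := analyticAt_seriesSum (thetaMuCoeff c).2)).2 ?_
  filter_upwards [hasFDerivAt_seriesSum c.2] with p ⟨A, hA, _, h2⟩
  change p.2 * fderiv ℂ (seriesSum c) p (0, 1) = _
  rw [hA.fderiv, ← h2.tsum_eq, ← tsum_mul_left]
  refine tsum_congr fun k => ?_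
  change _ = (k.2 : ℂ) * c.1 k * p.1 ^ k.1 * p.2 ^ k.2
  linear_combination c.1 k * p.1 ^ k.1 * natCast_mul_pow p.2 k.2

theorem lamOp_sumGerm (c : convSeries) : lamOp 0 (sumGerm c) = sumGerm (lamCoeff c) := by
  refine (HolGerm.of_eq_of (hu := analyticAt_fst.mul (analyticAt_seriesSum c.2))
    (hv := analyticAt_seriesSum (lamCoeff c).2)).2
    (Eventually.of_forall fun p => ?_)
  refine tsum_mul_left.symm.trans (Eq.trans ?_ (injective_succ_fst.tsum_eq fun k hk => ?_))
  · refine tsum_congr fun k => ?_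
    simp [lamCoeff, pow_succ]
    ring
  · by_contra h
    refine hk ?_
    simp [lamCoeff, eq_zero_of_notMem_range_succ_fst h]

theorem muOp_sumGerm (c : convSeries) : muOp 0 (sumGerm c) = sumGerm (muCoeff c) := by
  refine (HolGerm.of_eq_of (hu := analyticAt_snd.mul (analyticAt_seriesSum c.2))
    (hv := analyticAt_seriesSum (muCoeff c).2)).2
    (Eventually.of_forall fun p => ?_)
  refine tsum_mul_left.symm.trans (Eq.trans ?_ (injective_succ_snd.tsum_eq fun k hk => ?_))
  · refine tsum_congr fun k => ?_
    simp [muCoeff, pow_succ]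
    ring
  · by_contra h
    refine hk ?_
    simp [muCoeff, eq_zero_of_notMem_range_succ_snd h]

end PeriodDE

/-! ### The coefficients of the period series: growth, recurrences, and the differential equations.
-/

namespace PeriodDE

theorem factorial_add_le {a b N : ℕ} (h : a + b ≤ N) :
    (a + b).factorial ≤ 2 ^ N * (a.factorial * b.factorial) := by
  rw [← Nat.add_choose_mul_factorial_mul_factorial a b, mul_assoc]
  exact Nat.mul_le_mul_right _
    ((Nat.choose_le_two_pow _ _).trans (Nat.pow_le_pow_right two_pos h))

/-- A multinomial coefficient with five parts is a product of four binomial coefficients, each at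
most `2 ^ N`. -/
theorem factorial_five_le (a b c d e : ℕ) :
    (a + b + c + d + e).factorial ≤ 16 ^ (a + b + c + d + e) *
      (a.factorial * b.factorial * c.factorial * d.factorial * e.factorial) := by
  set N := a + b + c + d + e with hN
  have h1 : (a + b).factorial ≤ _ := factorial_add_le (N := N) (by omega)
  have h2 : (a + b + c).factorial ≤ _ := factorial_add_le (N := N) (by omega)
  have h3 : (a + b + c + d).factorial ≤ _ := factorial_add_le (N := N) (by omega)
  have h4 : N.factorial ≤ _ := factorial_add_le (N := N) hN.ge
  calc N.factorial ≤ 2 ^ N * ((2 ^ N * ((2 ^ N * ((2 ^ N * (a.factorial * b.factorial)) *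
        c.factorial)) * d.factorial)) * e.factorial) :=
        h4.trans <| Nat.mul_le_mul_left _ <| Nat.mul_le_mul_right _ <|
        h3.trans <| Nat.mul_le_mul_left _ <| Nat.mul_le_mul_right _ <|
        h2.trans <| Nat.mul_le_mul_left _ <| Nat.mul_le_mul_right _ h1
    _ = _ := by
        rw [show 16 = 2 * 2 * 2 * 2 from rfl, mul_pow, mul_pow, mul_pow]
        ring

theorem div_factorial_five_le (a b c d e : ℕ) :
    ((a + b + c + d + e).factorial : ℝ) /
      (a.factorial * b.factorial * c.factorial * d.factorial * e.factorial) ≤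
      16 ^ (a + b + c + d + e) := by
  rw [div_le_iff₀ (by positivity)]
  exact_mod_cast factorial_five_le a b c d e

/-- For each family the factorials in the denominator, counted with multiplicity, are five in number
and their arguments add up to that of the numerator. The absolute value is thus a multinomial
coefficient of total at most `5 (n + m)`. -/
theorem norm_etaCoeff_le (j : Fin 4) (n m : ℕ) :
    ‖etaCoeff j n m‖ ≤ (16 ^ 5) ^ (n + m) := by
  have h {a b c d e : ℕ} (hN : a + b + c + d + e ≤ 5 * (n + m)) :
      ((a + b + c + d + e).factorial : ℝ) /
      (a.factorial * b.factorial * c.factorial * d.factorial * e.factorial) ≤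
      (16 ^ 5) ^ (n + m) := by
    refine (div_factorial_five_le a b c d e).trans ?_
    rw [← pow_mul]
    exact pow_le_pow_right₀ (by norm_num) hN
  fin_cases j
  · refine Eq.trans_le ?_ (h (a := n) (b := m) (c := m) (d := m) (e := 2 * m + n) (by omega))
    rw [show n + m + m + m + (2 * m + n) = 5 * m + 2 * n by ring]
    simp [etaCoeff]
    ring
  · refine Eq.trans_le ?_ (h (a := n) (b := n) (c := m) (d := m) (e := n + m) (by omega))
    rw [show n + n + m + m + (n + m) = 3 * n + 3 * m by ring]
    simp [etaCoeff]
    ring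
  · refine Eq.trans_le ?_ (h (a := m) (b := m) (c := n) (d := m + n) (e := m + n) (by omega))
    rw [show m + m + n + (m + n) + (m + n) = 4 * m + 3 * n by ring]
    simp [etaCoeff]
    ring
  · refine Eq.trans_le ?_ (h (a := n) (b := n) (c := n) (d := m) (e := m) (by omega))
    rw [show n + n + n + m + m = 3 * n + 2 * m by ring]
    simp [etaCoeff]
    ring

theorem etaCoeff_mem_convSeries (j : Fin 4) : (fun k => etaCoeff j k.1 k.2) ∈ convSeries := by
  have hg : Summable fun n : ℕ => (1 / 2 : ℝ) ^ n := summable_geometric_two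
  -- This radius leaves a factor `1/2` per degree, so a product of two geometric series dominates.
  refine ⟨(2 * 16 ^ 5)⁻¹, by positivity, (hg.mul_of_nonneg hg (fun n => by positivity)
    fun n => by positivity).of_nonneg_of_le (fun k => by positivity) fun k => ?_⟩
  calc _ ≤ (16 ^ 5) ^ (k.1 + k.2) * ((2 * 16 ^ 5 : ℝ)⁻¹) ^ (k.1 + k.2) := by
        gcongr
        exact norm_etaCoeff_le j k.1 k.2
    _ = _ := by
        rw [← mul_pow, ← pow_add]
        norm_num

theorem etaCoeff_zero_succ (n m : ℕ) :
    (n + 1 : ℂ) * (2 * m + n + 1) * etaCoeff 0 (n + 1) m =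
      (5 * m + 2 * n + 1) * (5 * m + 2 * n + 2) * etaCoeff 0 n m := by
  have h : (2 * m + n + 1 : ℂ) ≠ 0 := by exact_mod_cast Nat.succ_ne_zero (2 * m + n)
  have h' : (n + 1 : ℂ) ≠ 0 := by exact_mod_cast Nat.succ_ne_zero n
  simp only [etaCoeff, show 5 * m + 2 * (n + 1) = 5 * m + 2 * n + 1 + 1 by ring, ← add_assoc,
    Nat.factorial_succ]
  push_cast
  field_simp
  ring

/-- Trading `lam ^ 2` for `mu` leaves `(2 m + n + 2)!` unchanged and raises the numerator's argument
by one only, so a low-order relation results. In families 1 and 2 the trade is of `lam` for `mu`. -/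
theorem etaCoeff_zero_exchange (n m : ℕ) :
    (n + 1 : ℂ) * (n + 2) * (5 * m + 2 * n + 5) * etaCoeff 0 (n + 2) m =
      -(m + 1) ^ 3 * etaCoeff 0 n (m + 1) := by
  have h : (m + 1 : ℂ) ≠ 0 := by exact_mod_cast Nat.succ_ne_zero m
  have h1 : (n + 1 : ℂ) ≠ 0 := by exact_mod_cast Nat.succ_ne_zero n
  have h2 : (n + 1 + 1 : ℂ) ≠ 0 := by exact_mod_cast Nat.succ_ne_zero (n + 1)
  simp only [etaCoeff, show 5 * m + 2 * (n + 2) = 5 * m + 2 * n + 4 by ring,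
    show 5 * (m + 1) + 2 * n = 5 * m + 2 * n + 4 + 1 by ring,
    show 2 * (m + 1) + n = 2 * m + (n + 2) by ring, show n + 2 = n + 1 + 1 by ring,
    Nat.factorial_succ]
  push_cast
  field_simp
  ring

theorem etaCoeff_one_succ (n m : ℕ) :
    (n + 1 : ℂ) ^ 2 * etaCoeff 1 (n + 1) m =
      -3 * (3 * (n + m) + 1) * (3 * (n + m) + 2) * etaCoeff 1 n m := by
  have h : (n + m + 1 : ℂ) ≠ 0 := by exact_mod_cast Nat.succ_ne_zero (n + m)
  have h' : (n + 1 : ℂ) ≠ 0 := by exact_mod_cast Nat.succ_ne_zero n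
  simp only [etaCoeff, show 3 * (n + 1) + 3 * m = 3 * n + 3 * m + 1 + 1 + 1 by ring,
    show n + 1 + m = n + m + 1 by ring, ← add_assoc, Nat.factorial_succ]
  push_cast
  field_simp
  ring

theorem etaCoeff_one_exchange (n m : ℕ) :
    (n + 1 : ℂ) ^ 2 * etaCoeff 1 (n + 1) m = (m + 1) ^ 2 * etaCoeff 1 n (m + 1) := by
  have h : (m + 1 : ℂ) ≠ 0 := by exact_mod_cast Nat.succ_ne_zero m
  have h' : (n + 1 : ℂ) ≠ 0 := by exact_mod_cast Nat.succ_ne_zero n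
  simp only [etaCoeff, show 3 * n + 3 * (m + 1) = 3 * (n + 1) + 3 * m by ring,
    show n + (m + 1) = n + 1 + m by ring, show m + (n + 1) = m + 1 + n by ring,
    Nat.factorial_succ n, Nat.factorial_succ m]
  push_cast
  field_simp

theorem etaCoeff_two_succ (n m : ℕ) :
    (n + 1 : ℂ) * (m + n + 1) ^ 2 * etaCoeff 2 (n + 1) m =
      -(4 * m + 3 * n + 1) * (4 * m + 3 * n + 2) * (4 * m + 3 * n + 3) * etaCoeff 2 n m := by
  have h : (m + n + 1 : ℂ) ≠ 0 := by exact_mod_cast Nat.succ_ne_zero (m + n)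
  have h' : (n + 1 : ℂ) ≠ 0 := by exact_mod_cast Nat.succ_ne_zero n
  simp only [etaCoeff, show 4 * m + 3 * (n + 1) = 4 * m + 3 * n + 1 + 1 + 1 by ring,
    ← add_assoc, Nat.factorial_succ]
  push_cast
  field_simp
  ring

theorem etaCoeff_two_exchange (n m : ℕ) :
    (n + 1 : ℂ) * (3 * n + 4 * m + 4) * etaCoeff 2 (n + 1) m =
      -(m + 1) ^ 2 * etaCoeff 2 n (m + 1) := by
  have h : (m + 1 : ℂ) ≠ 0 := by exact_mod_cast Nat.succ_ne_zero m
  have h' : (n + 1 : ℂ) ≠ 0 := by exact_mod_cast Nat.succ_ne_zero n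
  simp only [etaCoeff, show 4 * m + 3 * (n + 1) = 4 * m + 3 * n + 3 by ring,
    show 4 * (m + 1) + 3 * n = 4 * m + 3 * n + 3 + 1 by ring,
    show m + 1 + n = m + (n + 1) by ring, Nat.factorial_succ n, Nat.factorial_succ m,
    Nat.factorial_succ (4 * m + 3 * n + 3)]
  push_cast
  field_simp
  ring

theorem etaCoeff_three_succ_left (n m : ℕ) :
    (n + 1 : ℂ) ^ 3 * etaCoeff 3 (n + 1) m =
      -(3 * n + 2 * m + 1) * (3 * n + 2 * m + 2) * (3 * n + 2 * m + 3) * etaCoeff 3 n m := by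
  have h' : (n + 1 : ℂ) ≠ 0 := by exact_mod_cast Nat.succ_ne_zero n
  simp only [etaCoeff, show 3 * (n + 1) + 2 * m = 3 * n + 2 * m + 1 + 1 + 1 by ring,
    Nat.factorial_succ]
  push_cast
  field_simp
  ring

theorem etaCoeff_three_succ_right (n m : ℕ) :
    (m + 1 : ℂ) ^ 2 * etaCoeff 3 n (m + 1) =
      (3 * n + 2 * m + 1) * (3 * n + 2 * m + 2) * etaCoeff 3 n m := by
  have h' : (m + 1 : ℂ) ≠ 0 := by exact_mod_cast Nat.succ_ne_zero m
  simp only [etaCoeff, show 3 * n + 2 * (m + 1) = 3 * n + 2 * m + 1 + 1 by ring,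
    Nat.factorial_succ]
  push_cast
  field_simp
  ring

/-- The coefficients of `η_j / (2πi)²`, as a convergent double series. -/
noncomputable def etaSeries (j : Fin 4) : convSeries :=
  ⟨fun k => etaCoeff j k.1 k.2, etaCoeff_mem_convSeries j⟩

theorem D1_sumGerm_etaSeries (j : Fin 4) : D1 0 j (sumGerm (etaSeries j)) = 0 := by
  fin_cases j
  all_goals
    simp only [D1, LinearMap.sub_apply, LinearMap.add_apply, Module.End.mul_apply, pow_two,
      Module.End.one_apply, Module.End.ofNat_apply, thetaLam_sumGerm, thetaMu_sumGerm,
      lamOp_sumGerm, muOp_sumGerm, ← map_nsmul, ← map_add, ← map_sub]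
    refine (congrArg sumGerm ?_).trans (map_zero sumGerm)
    ext ⟨n, m⟩
    simp [thetaLamCoeff, thetaMuCoeff, lamCoeff, muCoeff, etaSeries]
  · rcases n with _ | n
    · simp
    · simp
      linear_combination etaCoeff_zero_succ n m
  · rcases n with _ | n <;> rcases m with _ | m
    · simp
    · simp
    · simp
    · simp
      linear_combination -etaCoeff_one_exchange n m
  · rcases n with _ | n <;> rcases m with _ | m
    · simp
    · simp
    · simp
    · simp
      linear_combination etaCoeff_two_exchange n m
  · rcases m with _ | m
    · simp
    · simp
      linear_combination etaCoeff_three_succ_right n m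

/-- Unlike for `D1`, one recurrence is in general not enough: two are combined, and the result is
the wanted relation times a linear factor in `n`, `m` (except for family 1, where no factor occurs).
That factor is nonzero at natural numbers and is cancelled. Indices at the boundary, where a shifted
coefficient is absent, are treated separately. -/
theorem D3_sumGerm_etaSeries (j : Fin 4) : D3 0 j (sumGerm (etaSeries j)) = 0 := by
  fin_cases j
  all_goals
    simp only [D3, LinearMap.sub_apply, LinearMap.add_apply, LinearMap.smul_apply,
      Module.End.mul_apply, pow_succ, pow_zero,
      Module.End.one_apply, Module.End.ofNat_apply, thetaLam_sumGerm, thetaMu_sumGerm,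
      lamOp_sumGerm, muOp_sumGerm, ← map_nsmul, ← map_smul, ← map_add, ← map_sub]
    refine (congrArg sumGerm ?_).trans (map_zero sumGerm)
    ext ⟨n, m⟩
    simp [thetaLamCoeff, thetaMuCoeff, lamCoeff, muCoeff, etaSeries]
  · rcases n with _ | _ | n
    · simp
    · simp
    rcases n with _ | n <;> rcases m with _ | m
    · simp
    · have h0 : (5 * m + 5 : ℂ) ≠ 0 := by exact_mod_cast Nat.succ_ne_zero (5 * m + 4)
      have h := etaCoeff_zero_exchange 0 m
      simp at h ⊢
      refine mul_left_cancel₀ h0 ?_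
      linear_combination 25 * h
    · have h0 : (2 * n + 2 : ℂ) ≠ 0 := by exact_mod_cast Nat.succ_ne_zero (2 * n + 1)
      have h := etaCoeff_zero_succ n 0
      simp at h ⊢
      refine mul_left_cancel₀ h0 ?_
      linear_combination 8 * (n + 1) * h
    -- This is the factor multiplying the coefficient of index `(n + 3, m)` in `h'`. In terms of the
    -- index `(N, M) = (n + 3, m + 1)` it is `5 M + 2 N - 4`, which also gives the factors of the
    -- two preceding boundary cases.
    · have h0 : (5 * m + 2 * n + 7 : ℂ) ≠ 0 := by
        exact_mod_cast Nat.succ_ne_zero (5 * m + 2 * n + 6)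
      have h := etaCoeff_zero_succ n (m + 1)
      have h' := etaCoeff_zero_exchange (n + 1) m
      simp at h h' ⊢
      refine mul_left_cancel₀ h0 ?_
      linear_combination 8 * (n + 1) * h + 25 * h'
  · rcases n with _ | n
    · simp
    · have h := etaCoeff_one_succ n m
      simp at h ⊢
      linear_combination (1 / 27) * h
  · rcases n with _ | _ | n
    · simp
    · simp
    rcases m with _ | m
    · have h0 : (n + 1 : ℂ) ≠ 0 := by exact_mod_cast Nat.succ_ne_zero n
      have h := etaCoeff_two_succ n 0
      simp at h ⊢
      refine mul_left_cancel₀ h0 ?_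
      linear_combination 3 * h
    · have h0 : (3 * n + 4 * m + 7 : ℂ) ≠ 0 := by
        exact_mod_cast Nat.succ_ne_zero (3 * n + 4 * m + 6)
      have h := etaCoeff_two_succ n (m + 1)
      have h' := etaCoeff_two_exchange (n + 1) m
      simp at h h' ⊢
      refine mul_left_cancel₀ h0 ?_
      linear_combination 9 * h - (n + 1) * h'
  · rcases n with _ | n
    · simp
    rcases m with _ | m
    · have h0 : (n + 1 : ℂ) ≠ 0 := by exact_mod_cast Nat.succ_ne_zero n
      have h := etaCoeff_three_succ_left n 0
      simp at h ⊢
      refine mul_left_cancel₀ h0 ?_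
      linear_combination 3 * h
    · have h0 : (3 * n + 2 * m + 5 : ℂ) ≠ 0 := by
        exact_mod_cast Nat.succ_ne_zero (3 * n + 2 * m + 4)
      have h := etaCoeff_three_succ_left n (m + 1)
      have h' := etaCoeff_three_succ_right (n + 1) m
      simp at h h' ⊢
      refine mul_left_cancel₀ h0 ?_
      -- The combination rests on `9 (n+1)^2 - 4 (m+1)^2` being a difference of squares: one factor
      -- is that of `3X - 2Y`, the other is the cancelled `3 n + 2 m + 5`.
      linear_combination 9 * h - 4 * (n + 1) * h'

theorem eta_spec (j : Fin 4) :
    (∀ᶠ p in 𝓝 (0 : ℂ × ℂ), Summable (etaTerm j p)) ∧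
      ∃ hη : AnalyticAt ℂ (eta j) (0 : ℂ × ℂ),
        D1 0 j (HolGerm.of (eta j) hη) = 0 ∧ D3 0 j (HolGerm.of (eta j) hη) = 0 := by
  have hη : AnalyticAt ℂ (eta j) (0 : ℂ × ℂ) :=
    analyticAt_const.mul (analyticAt_seriesSum (etaSeries j).2)
  have h : HolGerm.of (eta j) hη =
      (2 * (Real.pi : ℂ) * Complex.I) ^ 2 • sumGerm (etaSeries j) := rfl
  refine ⟨eventually_summable (etaSeries j).2, hη, ?_, ?_⟩
  · rw [h, map_smul, D1_sumGerm_etaSeries, smul_zero]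
  · rw [h, map_smul, D3_sumGerm_etaSeries, smul_zero]

end PeriodDE

theorem theorem4p1 (j : Fin 4) :
    ((∀ᶠ p in 𝓝 (0 : ℂ × ℂ), Summable (PeriodDE.etaTerm j p)) ∧
      ∃ hη : AnalyticAt ℂ (PeriodDE.eta j) (0 : ℂ × ℂ),
        PeriodDE.D1 0 j (PeriodDE.HolGerm.of (PeriodDE.eta j) hη) = 0 ∧
        PeriodDE.D3 0 j (PeriodDE.HolGerm.of (PeriodDE.eta j) hη) = 0) ∧
    ∀ p ∈ PeriodDE.Lambda j, Module.finrank ℂ (PeriodDE.solutions p j) = 4 :=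
  ⟨PeriodDE.eta_spec j, fun _ hp => PeriodDE.finrank_solutions j hp⟩
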